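/- A vector-matrix-vector query to an unknown real symmetric matrix $A\in\mathbb{R}^{d\times d}$ consists of a pair $(v,w)$ of vectors in $\mathbb{R}^d$ and is answered by $v^TAw$. A randomized algorithm is non-adaptive if its queries depend only on its random seed; it uses one additional round of adaptivity if a second batch of queries may also depend on the answers to a first, non-adaptive batch. Queries and outputs are Borel measurable functions, jointly in the seed and the answers on which they depend; only queries are counted. There is an absolute constant $C>0$ such that the following holds for all integers $1\le k\le d$ and all $0<\epsilon<1$. For a real symmetric $d\times d$ matrix $A$, let $\lambda_1,\dots,\lambda_d$ be its signed eigenvalues with multiplicity, sorted so that $|\lambda_1|\ge|\lambda_2|\ge\dots\ge|\lambda_d|$ (ties in any order), and let $\|A\|_F$ be its Frobenius norm. There is a randomized non-adaptive algorithm making at most $C\,\frac{k^2}{\epsilon^{12}}\log(k+1)$ vector-matrix-vector queries which, for every real symmetric $d\times d$ matrix $A$, with probability at least $0.9$ outputs $\tilde\lambda_1,\dots,\tilde\lambda_k\in\mathbb{R}$ such that (i) there exists a permutation $\sigma$ of $\{1,\dots,k\}$ such that $|\tilde\lambda_{\sigma(i)}-\lambda_i|\le\epsilon\|A\|_F$ for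 all $i\in\{1,\dots,k\}$ with $|\lambda_i|\ge|\lambda_k|+2\epsilon\|A\|_F$; and (ii) for every $i\in\{1,\dots,k\}$ there exists $j\in\{1,\dots,d\}$ with $|\lambda_j|\ge|\lambda_k|-\epsilon\|A\|_F$ and $|\tilde\lambda_i-\lambda_j|\le\epsilon\|A\|_F$. With one additional round of adaptivity, there is an algorithm with the same guarantee that makes at most $C\,\frac{k^2}{\epsilon^{8}}\log(k+1)$ vector-matrix-vector queries in total. -/

import Mathlib

open MeasureTheory
open scoped Matrix

noncomputable section

/-- The Frobenius norm `‖A‖_F = (∑ A_{ij}²)^{1/2}` of a real matrix (Mathlib's Frobenius norm). -/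
def frobNorm {d : ℕ} (A : Matrix (Fin d) (Fin d) ℝ) : ℝ :=
  @norm _ Matrix.frobeniusNormedAddCommGroup.toNorm A

/-- The answer `vᵀ A w` to the vector-matrix-vector query `(v, w)`. -/
def vmvAnswer {d : ℕ} (A : Matrix (Fin d) (Fin d) ℝ) (v w : Fin d → ℝ) : ℝ :=
  v ⬝ᵥ (A *ᵥ w)

/-- `lam` lists the eigenvalues of the real symmetric matrix `A`, with multiplicity,
in decreasing order of magnitude (ties may be ordered in any way). -/
structure IsSpectrumByMagnitude {d : ℕ} {A : Matrix (Fin d) (Fin d) ℝ} (hA : A.IsHermitian)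
    (lam : Fin d → ℝ) : Prop where
  enumerates : ∃ e : Equiv.Perm (Fin d), lam = hA.eigenvalues ∘ e
  antitone_abs : Antitone fun i => |lam i|

/-- A randomized non-adaptive algorithm that makes `q` vector-matrix-vector queries to a
`d × d` matrix and outputs `k` real numbers. The queries depend on the random seed only; the output
is computed from the seed and the answers. Both are Borel functions of the data they
depend on (jointly in seed and answers); otherwise arbitrary computation is free. -/
structure NonadaptiveVMV (d k q : ℕ) where
  /-- The space of random seeds. -/
  Seed : Type
  [instMeasurableSpace : MeasurableSpace Seed]
  /-- The distribution of the random seed. -/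
  law : Measure Seed
  [instIsProbabilityMeasure : IsProbabilityMeasure law]
  /-- The left vectors of the queries. -/
  left : Seed → Fin q → Fin d → ℝ
  /-- The right vectors of the queries. -/
  right : Seed → Fin q → Fin d → ℝ
  /-- The output, from the seed and the answers. -/
  output : Seed × (Fin q → ℝ) → Fin k → ℝ
  measurable_left : Measurable left
  measurable_right : Measurable right
  measurable_output : Measurable output

/-- The output of a non-adaptive algorithm on the matrix `A` with random seed `s`. -/
def NonadaptiveVMV.run {d k q : ℕ} (alg : NonadaptiveVMV d k q) (A : Matrix (Fin d) (Fin d) ℝ)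
    (s : alg.Seed) : Fin k → ℝ :=
  alg.output (s, fun j => vmvAnswer A (alg.left s j) (alg.right s j))

/-- A randomized algorithm with one additional round of adaptivity: it makes `q₁`
vector-matrix-vector queries that depend on the random seed only, then `q₂` further queries that
depend on the seed and on the answers of the first round, and outputs `k` real numbers
computed from the seed and all `q₁ + q₂` answers. -/
structure TwoRoundVMV (d k q₁ q₂ : ℕ) where
  /-- The space of random seeds. -/
  Seed : Type
  [instMeasurableSpace : MeasurableSpace Seed]
  /-- The distribution of the random seed. -/
  law : Measure Seed
  [instIsProbabilityMeasure : IsProbabilityMeasure law]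
  /-- The left vectors of the first round of queries. -/
  left₁ : Seed → Fin q₁ → Fin d → ℝ
  /-- The right vectors of the first round of queries. -/
  right₁ : Seed → Fin q₁ → Fin d → ℝ
  /-- The left vectors of the second round of queries. -/
  left₂ : Seed × (Fin q₁ → ℝ) → Fin q₂ → Fin d → ℝ
  /-- The right vectors of the second round of queries. -/
  right₂ : Seed × (Fin q₁ → ℝ) → Fin q₂ → Fin d → ℝ
  /-- The output, from the seed and the answers of both rounds. -/
  output : Seed × (Fin q₁ → ℝ) × (Fin q₂ → ℝ) → Fin k → ℝ
  measurable_left₁ : Measurable left₁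
  measurable_right₁ : Measurable right₁
  measurable_left₂ : Measurable left₂
  measurable_right₂ : Measurable right₂
  measurable_output : Measurable output

/-- The answers that a two-round algorithm receives in its first round. -/
def TwoRoundVMV.answers₁ {d k q₁ q₂ : ℕ} (alg : TwoRoundVMV d k q₁ q₂)
    (A : Matrix (Fin d) (Fin d) ℝ) (s : alg.Seed) : Fin q₁ → ℝ :=
  fun j => vmvAnswer A (alg.left₁ s j) (alg.right₁ s j)

/-- The answers that a two-round algorithm receives in its second round. -/
def TwoRoundVMV.answers₂ {d k q₁ q₂ : ℕ} (alg : TwoRoundVMV d k q₁ q₂)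
    (A : Matrix (Fin d) (Fin d) ℝ) (s : alg.Seed) : Fin q₂ → ℝ :=
  fun j => vmvAnswer A (alg.left₂ (s, alg.answers₁ A s) j) (alg.right₂ (s, alg.answers₁ A s) j)

/-- The output of a two-round algorithm on the matrix `A` with random seed `s`. -/
def TwoRoundVMV.run {d k q₁ q₂ : ℕ} (alg : TwoRoundVMV d k q₁ q₂)
    (A : Matrix (Fin d) (Fin d) ℝ) (s : alg.Seed) : Fin k → ℝ :=
  alg.output (s, alg.answers₁ A s, alg.answers₂ A s)

/-- The accuracy guarantee for estimates `est` of the top `k` eigenvalues, where `lam` lists the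
eigenvalues by decreasing magnitude and `F` is the Frobenius norm of the matrix.
Indices start at `0`, so that the `k`-th eigenvalue is `lam ⟨k - 1, _⟩`. -/
structure AccurateTopEigenvalues {d k : ℕ} (hk : 1 ≤ k) (hkd : k ≤ d) (ε F : ℝ)
    (lam : Fin d → ℝ) (est : Fin k → ℝ) : Prop where
  /-- Up to a permutation, every well separated top eigenvalue is approximated. -/
  separated : ∃ σ : Equiv.Perm (Fin k), ∀ i : Fin k,
    |lam ⟨k - 1, by omega⟩| + 2 * ε * F ≤ |lam (Fin.castLE hkd i)| →
      |est (σ i) - lam (Fin.castLE hkd i)| ≤ ε * F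
  /-- Every estimate is close to some eigenvalue of large magnitude. -/
  sound : ∀ i : Fin k, ∃ j : Fin d,
    |lam ⟨k - 1, by omega⟩| - ε * F ≤ |lam j| ∧ |est i - lam j| ≤ ε * F

/-- For every symmetric input matrix, the non-adaptive algorithm outputs accurate signed estimates
of its top `k` eigenvalues with probability at least `9/10`. -/
def NonadaptiveVMV.ApproximatesTopEigenvalues {d k q : ℕ} (alg : NonadaptiveVMV d k q)
    (hk : 1 ≤ k) (hkd : k ≤ d) (ε : ℝ) : Prop :=
  ∀ (A : Matrix (Fin d) (Fin d) ℝ) (hA : A.IsHermitian) (lam : Fin d → ℝ),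
    IsSpectrumByMagnitude hA lam →
      9 / 10 ≤ (@Measure.real alg.Seed alg.instMeasurableSpace alg.law
        {s | AccurateTopEigenvalues hk hkd ε (frobNorm A) lam (alg.run A s)})

/-- For every symmetric input matrix, the two-round algorithm outputs accurate signed estimates
of its top `k` eigenvalues with probability at least `9/10`. -/
def TwoRoundVMV.ApproximatesTopEigenvalues {d k q₁ q₂ : ℕ} (alg : TwoRoundVMV d k q₁ q₂)
    (hk : 1 ≤ k) (hkd : k ≤ d) (ε : ℝ) : Prop :=
  ∀ (A : Matrix (Fin d) (Fin d) ℝ) (hA : A.IsHermitian) (lam : Fin d → ℝ),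
    IsSpectrumByMagnitude hA lam →
      9 / 10 ≤ (@Measure.real alg.Seed alg.instMeasurableSpace alg.law
        {s | AccurateTopEigenvalues hk hkd ε (frobNorm A) lam (alg.run A s)})

end

/-! Query all pairs among M = O(ε⁻⁴) independent random sign vectors x_a, let H have off-diagonal
entries x_aᵀ A x_b / M and zero diagonal, and return the k eigenvalues of H of largest magnitude,
with zeros as padding. This costs M² = O(ε⁻⁸) queries whatever k is, so a single non-adaptive
algorithm meets both bounds and the second round can stay empty. The diagonal is dropped because
x_aᵀ A x_a has mean tr A, which ‖A‖_F does not control independently of d.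

To compare H with A, let Y have rows (A x_a)ᵀ / √M. Then YᵀY ≈ A², HY ≈ YA and YYᵀ ≈ H², with total
squared Frobenius error at most 18 ‖A‖_F⁴ / M on average (`IsotropicFamily.expect_sketchError_le`).
Up to scaling, each residual comes from a sum of independent centered matrices A(xxᵀ - 1)A plus a
multiple of A², possibly multiplied by sign vectors, so second and fourth moments suffice. Markov's
inequality bounds the error by δ⁴, δ = ε‖A‖_F/6, with probability 9/10.

The approximate identities force the sorted positive eigenvalues of A and H to agree within 2δ, by a
Courant–Fischer argument (`posTerm_le_add_of_intertwining`). The hypotheses are symmetric under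
exchanging A with H and Y with Yᵀ, and under negating A and H, which gives both directions and both
signs (`abs_signedTerm_sub_le_of_frobSq_le`). A deterministic argument turns uniform closeness of
the padded spectra into the guarantee on the selected values
(`accurateTopEigenvalues_of_abs_sub_le`). -/

/-! ### Min-max comparison of sorted positive eigenvalues. -/

section SortedParts

open scoped InnerProductSpace

variable {E F : Type*} [NormedAddCommGroup E] [InnerProductSpace ℝ E]
  [NormedAddCommGroup F] [InnerProductSpace ℝ F] {n m : ℕ}

/-- The `j`-th term of the finite sequence `l`, truncated below at `0` and continued by zeros. -/
noncomputable def posTerm (l : Fin n → ℝ) (j : ℕ) : ℝ :=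
  if h : j < n then max (l ⟨j, h⟩) 0 else 0

theorem posTerm_nonneg (l : Fin n → ℝ) (j : ℕ) : 0 ≤ posTerm l j := by
  unfold posTerm
  split_ifs
  · exact le_max_right _ _
  · exact le_rfl

theorem OrthonormalBasis.inner_eigen {T : E →ₗ[ℝ] E} (hT : T.IsSymmetric)
    (b : OrthonormalBasis (Fin n) ℝ E) {l : Fin n → ℝ} (hb : ∀ i, T (b i) = l i • b i)
    (i : Fin n) (x : E) : ⟪b i, T x⟫_ℝ = l i * ⟪b i, x⟫_ℝ := by
  rw [← hT, hb, real_inner_smul_left]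

/-- There is a nonzero vector in the span of the first `j + 1` vectors of one basis whose image is
orthogonal to the first `j` vectors of another one. -/
theorem exists_ne_zero_inner_eq_zero (b : OrthonormalBasis (Fin n) ℝ E)
    (b' : OrthonormalBasis (Fin m) ℝ F) (Y : E →ₗ[ℝ] F) {j : ℕ} (hj : j < n) :
    ∃ u : E, u ≠ 0 ∧ (∀ i : Fin n, j < i → ⟪b i, u⟫_ℝ = 0) ∧
      ∀ i : Fin m, (i : ℕ) < j → ⟪b' i, Y u⟫_ℝ = 0 := by
  let f : E →ₗ[ℝ] ({i : Fin n // j < i} → ℝ) × ({i : Fin m // (i : ℕ) < j} → ℝ) :=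
    (LinearMap.pi fun i => (innerₛₗ ℝ (b i.1))).prod
      (LinearMap.pi fun i => (innerₛₗ ℝ (b' i.1)) ∘ₗ Y)
  have : FiniteDimensional ℝ E := b.toBasis.finiteDimensional_of_finite
  have h1 : Fintype.card {i : Fin n // j < i} = n - 1 - j := by
    have := Fin.card_Ioi (⟨j, hj⟩ : Fin n)
    rw [Fintype.card_subtype, ← this]
    congr 1
    ext i
    simp [Fin.lt_def]
  have h2 : Fintype.card {i : Fin m // (i : ℕ) < j} ≤ j := by
    have := Fintype.card_le_of_injective
      (fun i : {i : Fin m // (i : ℕ) < j} => (⟨i.1, i.2⟩ : Fin j))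
      (fun a c h => by
        have := congrArg Fin.val h
        exact Subtype.ext (Fin.ext this))
    simpa using this
  -- The n - 1 - j conditions on u and the at most j conditions on Y u together number less than n.
  have hlt : Module.finrank ℝ (({i : Fin n // j < i} → ℝ) × ({i : Fin m // (i : ℕ) < j} → ℝ)) <
      Module.finrank ℝ E := by
    rw [Module.finrank_prod, Module.finrank_fintype_fun_eq_card,
      Module.finrank_fintype_fun_eq_card, Module.finrank_eq_card_basis b.toBasis, h1,
      Fintype.card_fin]
    omega
  obtain ⟨u, hu, hu0⟩ := (Submodule.ne_bot_iff _).1 (f.ker_ne_bot_of_finrank_lt hlt)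
  rw [LinearMap.mem_ker] at hu
  refine ⟨u, hu0, fun i hi => ?_, fun i hi => ?_⟩
  · exact congrFun (congrArg Prod.fst hu) ⟨i, hi⟩
  · exact congrFun (congrArg Prod.snd hu) ⟨i, hi⟩

theorem inner_map_self_le {T : F →ₗ[ℝ] F} (hT : T.IsSymmetric)
    (b : OrthonormalBasis (Fin m) ℝ F) {l : Fin m → ℝ} (hb : ∀ i, T (b i) = l i • b i)
    (hl : Antitone l) {j : ℕ} {y : F} (hy : ∀ i : Fin m, (i : ℕ) < j → ⟪b i, y⟫_ℝ = 0) :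
    ⟪y, T y⟫_ℝ ≤ posTerm l j * ‖y‖ ^ 2 := by
  rw [← real_inner_self_eq_norm_sq, ← b.sum_inner_mul_inner, ← b.sum_inner_mul_inner,
    Finset.mul_sum]
  refine Finset.sum_le_sum fun i _ => ?_
  rw [b.inner_eigen hT hb, real_inner_comm (b i) y]
  by_cases hi : (i : ℕ) < j
  · simp [hy i hi]
  · have hj : j < m := by omega
    have h1 : l i ≤ posTerm l j := by
      rw [posTerm, dif_pos hj]
      exact le_max_of_le_left (hl (Fin.le_def.2 (not_lt.1 hi)))
    nlinarith [mul_le_mul_of_nonneg_right h1 (sq_nonneg ⟪b i, y⟫_ℝ)]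

theorem le_inner_map_self {T : E →ₗ[ℝ] E} (hT : T.IsSymmetric)
    (b : OrthonormalBasis (Fin n) ℝ E) {l : Fin n → ℝ} (hb : ∀ i, T (b i) = l i • b i)
    (hl : Antitone l) {j : Fin n} {u : E} (hu : ∀ i : Fin n, j < i → ⟪b i, u⟫_ℝ = 0) :
    l j * ‖u‖ ^ 2 ≤ ⟪u, T u⟫_ℝ := by
  rw [← real_inner_self_eq_norm_sq, ← b.sum_inner_mul_inner, ← b.sum_inner_mul_inner,
    Finset.mul_sum]
  refine Finset.sum_le_sum fun i _ => ?_
  rw [b.inner_eigen hT hb, real_inner_comm (b i) u]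
  by_cases hi : j < i
  · simp [hu i hi]
  · nlinarith [mul_le_mul_of_nonneg_right (hl (not_lt.1 hi)) (sq_nonneg ⟪b i, u⟫_ℝ)]

theorem mul_norm_le_norm_map {T : E →ₗ[ℝ] E} (hT : T.IsSymmetric)
    (b : OrthonormalBasis (Fin n) ℝ E) {l : Fin n → ℝ} (hb : ∀ i, T (b i) = l i • b i)
    (hl : Antitone l) {j : Fin n} {u : E} (hu : ∀ i : Fin n, j < i → ⟪b i, u⟫_ℝ = 0) :
    l j * ‖u‖ ≤ ‖T u‖ := by
  rcases eq_or_ne u 0 with rfl | h0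
  · simp
  have h1 := le_inner_map_self hT b hb hl hu
  have h2 := real_inner_le_norm u (T u)
  have h3 : 0 < ‖u‖ := norm_pos_iff.2 h0
  nlinarith

/-- Weyl's inequality for the truncated sorted eigenvalues. -/
theorem posTerm_le_add_of_norm_sub_le {S T : E →ₗ[ℝ] E} (hS : S.IsSymmetric) (hT : T.IsSymmetric)
    (b b' : OrthonormalBasis (Fin n) ℝ E) {l l' : Fin n → ℝ} (hb : ∀ i, S (b i) = l i • b i)
    (hb' : ∀ i, T (b' i) = l' i • b' i) (hl : Antitone l) (hl' : Antitone l') {η : ℝ}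
    (h : ∀ x, ‖S x - T x‖ ≤ η * ‖x‖) (hη : 0 ≤ η) (j : ℕ) :
    posTerm l j ≤ posTerm l' j + η := by
  have h0 := posTerm_nonneg l' j
  by_cases hj : j < n
  swap
  · rw [posTerm, dif_neg hj]
    positivity
  rw [posTerm, dif_pos hj]
  refine max_le ?_ (by positivity)
  obtain ⟨u, hu0, hu, hu'⟩ := exists_ne_zero_inner_eq_zero b b' LinearMap.id hj
  have h1 := le_inner_map_self (j := ⟨j, hj⟩) hS b hb hl fun i hi => hu i hi
  have h2 := inner_map_self_le hT b' hb' hl' hu'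
  have h3 := (real_inner_le_norm u (S u - T u)).trans
    (mul_le_mul_of_nonneg_left (h u) (norm_nonneg u))
  rw [inner_sub_right] at h3
  have h4 : 0 < ‖u‖ ^ 2 := by positivity
  simp only [LinearMap.id_apply] at h2
  refine le_of_mul_le_mul_right ?_ h4
  nlinarith

/-- If `Y` approximately intertwines `A` and `H`, and `Yᵀ Y` is close to `A²`, then the positive
eigenvalues of `H` are not much smaller than those of `A`. -/
theorem posTerm_le_add_of_intertwining {A : E →ₗ[ℝ] E} {H : F →ₗ[ℝ] F} (hA : A.IsSymmetric)
    (hH : H.IsSymmetric) (b : OrthonormalBasis (Fin n) ℝ E) (b' : OrthonormalBasis (Fin m) ℝ F)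
    {l : Fin n → ℝ} {l' : Fin m → ℝ} (hb : ∀ i, A (b i) = l i • b i)
    (hb' : ∀ i, H (b' i) = l' i • b' i) (hl : Antitone l) (hl' : Antitone l') (Y : E →ₗ[ℝ] F)
    {δ : ℝ} (hδ : 0 ≤ δ) (hY : ∀ u v, |⟪Y u, Y v⟫_ℝ - ⟪A u, A v⟫_ℝ| ≤ δ ^ 2 * ‖u‖ * ‖v‖)
    (hHY : ∀ u, ‖H (Y u) - Y (A u)‖ ≤ δ ^ 2 * ‖u‖) (j : ℕ) :
    posTerm l j ≤ posTerm l' j + 2 * δ := by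
  have h0 := posTerm_nonneg l' j
  by_cases hj : j < n
  swap
  · rw [posTerm, dif_neg hj]
    positivity
  rw [posTerm, dif_pos hj]
  refine max_le ?_ (by positivity)
  -- For the test vector u, ⟪Y u, H Y u⟫ is at most r‖Y u‖² ≈ r‖A u‖², yet it is close to ⟪Y u, Y A
  -- u⟫ ≈ ⟪A u, A A u⟫ ≥ t‖A u‖². A gap t - r > 2δ exceeds what the errors allow.
  by_contra! hlt
  obtain ⟨u, hu0, hu, hu'⟩ := exists_ne_zero_inner_eq_zero b b' Y hj
  have hu1 : ∀ i : Fin n, (⟨j, hj⟩ : Fin n) < i → ⟪b i, u⟫_ℝ = 0 := fun i hi => hu i hi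
  have hAu : ∀ i : Fin n, (⟨j, hj⟩ : Fin n) < i → ⟪b i, A u⟫_ℝ = 0 := fun i hi => by
    rw [b.inner_eigen hA hb, hu1 i hi, mul_zero]
  have h1 := mul_norm_le_norm_map hA b hb hl hu1
  have h2 := le_inner_map_self hA b hb hl hAu
  have h3 := inner_map_self_le hH b' hb' hl' hu'
  have h4 := abs_le.1 (hY u u)
  have h5 := abs_le.1 (hY u (A u))
  have h6 := abs_le.1 ((abs_real_inner_le_norm (Y u) (H (Y u) - Y (A u))).trans
    (mul_le_mul_of_nonneg_left (hHY u) (norm_nonneg _)))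
  rw [inner_sub_right] at h6
  rw [real_inner_self_eq_norm_sq, real_inner_self_eq_norm_sq] at h4
  set t := l ⟨j, hj⟩
  set p := ‖u‖
  set s := ‖A u‖
  set y := ‖Y u‖
  set r := posTerm l' j
  have hp : 0 < p := norm_pos_iff.2 hu0
  have ht : 2 * δ < t := by linarith
  have ht0 : 0 < t := by linarith
  have hs : 0 < s := lt_of_lt_of_le (by positivity) h1
  -- Large t makes δ‖u‖ small against ‖A u‖; hence errors δ²‖u‖‖A u‖ can be charged to δ‖A u‖².
  have hδp : 2 * (δ * p) ≤ s := by nlinarith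
  have hδp0 : 0 ≤ δ * p := by positivity
  have hδp2 : (δ * p) ^ 2 ≤ s ^ 2 / 4 := by nlinarith
  have hy1 : y ^ 2 ≤ 2 * s ^ 2 := by nlinarith [h4.2]
  have hy2 : y ≤ 2 * s := by
    have : 0 ≤ y := norm_nonneg _
    nlinarith
  have hy3 : 0 < y ^ 2 := by nlinarith [h4.1, sq_pos_of_pos hs]
  -- One error term comes from `h5` and two from `h6`, through y ≤ 2s.
  have e1 : t * s ^ 2 - 3 * (δ ^ 2 * p * s) ≤ r * y ^ 2 := by
    have : y * (δ ^ 2 * p) ≤ 2 * s * (δ ^ 2 * p) :=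
      mul_le_mul_of_nonneg_right hy2 (by positivity)
    nlinarith [h5.1, h6.1]
  have e2 : r * y ^ 2 < (t - 2 * δ) * y ^ 2 := mul_lt_mul_of_pos_right (by linarith) hy3
  have e3 : (t - 2 * δ) * y ^ 2 ≤ (t - 2 * δ) * (s ^ 2 + (δ * p) ^ 2) :=
    mul_le_mul_of_nonneg_left (by nlinarith [h4.2]) (by linarith)
  have e4 : t * (δ * p) ^ 2 ≤ δ * (s * (δ * p)) := by
    have := mul_le_mul_of_nonneg_right h1 (mul_nonneg hδ hδp0)
    nlinarith
  have e5 : δ * (s * (δ * p)) ≤ δ * (s ^ 2 / 2) :=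
    mul_le_mul_of_nonneg_left (by nlinarith) hδ
  nlinarith [mul_nonneg hδ (sq_nonneg (δ * p))]

end SortedParts

/-! ### Moments of centered rank-one matrices. -/

section Moments

open scoped BigOperators

variable {R : Type*} [Fintype R] {d M : ℕ}

/-- Averages over `Fin M → R` may be computed by first resampling one coordinate. -/
theorem expect_resample (c : Fin M) (f : (Fin M → R) → ℝ) :
    𝔼 ω, f ω = 𝔼 ω, 𝔼 r, f (Function.update ω c r) := by
  classical
  rcases isEmpty_or_nonempty R with hR | hR
  · have : IsEmpty (Fin M → R) := ⟨fun ω => hR.false (ω c)⟩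
    simp
  -- Exchanging the fresh value with the old coordinate is an involution, so it preserves the
  -- uniform average.
  let e : (Fin M → R) × R ≃ (Fin M → R) × R :=
    { toFun := fun p => (Function.update p.1 c p.2, p.1 c)
      invFun := fun p => (Function.update p.1 c p.2, p.1 c)
      left_inv := fun p => by simp
      right_inv := fun p => by simp }
  have h1 : 𝔼 ω, 𝔼 r, f (Function.update ω c r) =
      𝔼 p : (Fin M → R) × R, f (Function.update p.1 c p.2) := by
    rw [← Finset.univ_product_univ, Finset.expect_product]
  have h2 : 𝔼 p : (Fin M → R) × R, f (Function.update p.1 c p.2) =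
      𝔼 p : (Fin M → R) × R, f p.1 := Fintype.expect_equiv e _ _ fun p => rfl
  rw [h1, h2, ← Finset.univ_product_univ, Finset.expect_product]
  simp

/-- The second moment of a sum of independent centered terms and a constant. -/
theorem expect_sq_sum_add [Nonempty R] (W : R → ℝ) (hW : 𝔼 r, W r = 0) (S : Finset (Fin M))
    (β : ℝ) : 𝔼 ω : Fin M → R, (∑ c ∈ S, W (ω c) + β) ^ 2 = S.card * 𝔼 r, W r ^ 2 + β ^ 2 := by
  classical
  induction S using Finset.induction_on with
  | empty => simp
  | insert c S hc ih =>
    rw [expect_resample c]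
    have h : ∀ (ω : Fin M → R) r,
        (∑ c' ∈ insert c S, W (Function.update ω c r c') + β) ^ 2 =
          W r ^ 2 + W r * (2 * (∑ c' ∈ S, W (ω c') + β)) + (∑ c' ∈ S, W (ω c') + β) ^ 2 := by
      intro ω r
      rw [Finset.sum_insert hc, Function.update_self]
      have : ∑ c' ∈ S, W (Function.update ω c r c') = ∑ c' ∈ S, W (ω c') :=
        Finset.sum_congr rfl fun c' hc' => by
          rw [Function.update_of_ne (ne_of_mem_of_not_mem hc' hc)]
      rw [this]
      ring
    simp_rw [h, Finset.expect_add_distrib, ← Finset.expect_mul, hW, Fintype.expect_const]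
    rw [ih, Finset.card_insert_of_notMem hc]
    simp
    ring

/-- The sum of the squares of the entries of a matrix. -/
def frobSq {m n : ℕ} (B : Matrix (Fin m) (Fin n) ℝ) : ℝ := ∑ i, ∑ j, B i j ^ 2

theorem frobSq_nonneg {m n : ℕ} (B : Matrix (Fin m) (Fin n) ℝ) : 0 ≤ frobSq B :=
  Finset.sum_nonneg fun _ _ => Finset.sum_nonneg fun _ _ => sq_nonneg _

theorem frobSq_smul {m n : ℕ} (c : ℝ) (B : Matrix (Fin m) (Fin n) ℝ) :
    frobSq (c • B) = c ^ 2 * frobSq B := by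
  simp [frobSq, Finset.mul_sum, mul_pow]

theorem dotProduct_sq_le {n : ℕ} (u v : Fin n → ℝ) : (u ⬝ᵥ v) ^ 2 ≤ (u ⬝ᵥ u) * (v ⬝ᵥ v) := by
  have := Finset.sum_mul_sq_le_sq_mul_sq Finset.univ u v
  simpa [dotProduct, sq] using this

theorem dotProduct_mulVec_self_le {m n : ℕ} (B : Matrix (Fin m) (Fin n) ℝ) (v : Fin n → ℝ) :
    (B *ᵥ v) ⬝ᵥ (B *ᵥ v) ≤ frobSq B * (v ⬝ᵥ v) := by
  rw [frobSq, Finset.sum_mul]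
  refine Finset.sum_le_sum fun i _ => ?_
  have := dotProduct_sq_le (B i) v
  calc (B *ᵥ v) i * (B *ᵥ v) i = (B i ⬝ᵥ v) ^ 2 := by rw [sq]; rfl
    _ ≤ _ := this
    _ = _ := by simp [dotProduct, sq]

theorem frobSq_mul_le {m n p : ℕ} (A : Matrix (Fin m) (Fin n) ℝ) (B : Matrix (Fin n) (Fin p) ℝ) :
    frobSq (A * B) ≤ frobSq A * frobSq B := by
  have h : ∀ i j, (A * B) i j ^ 2 ≤ (∑ k, A i k ^ 2) * ∑ k, B k j ^ 2 := fun i j => by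
    rw [Matrix.mul_apply]
    exact Finset.sum_mul_sq_le_sq_mul_sq _ _ _
  refine (Finset.sum_le_sum fun i _ => Finset.sum_le_sum fun j _ => h i j).trans_eq ?_
  rw [frobSq, frobSq, Finset.sum_comm (s := Finset.univ) (f := fun i j => B i j ^ 2),
    Finset.sum_mul_sum]

/-- A finite family of vectors whose uniform average has the second moments of an isotropic
distribution and fourth moments bounded as for a Gaussian one. -/
structure IsotropicFamily (g : R → Fin d → ℝ) : Prop where
  second : ∀ i j, 𝔼 r, g r i * g r j = if i = j then 1 else 0
  fourth : ∀ u : Fin d → ℝ, 𝔼 r, (u ⬝ᵥ g r) ^ 4 ≤ 3 * (u ⬝ᵥ u) ^ 2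

namespace IsotropicFamily

variable {g : R → Fin d → ℝ}

theorem expect_dotProduct_mul (hg : IsotropicFamily g) (u v : Fin d → ℝ) :
    𝔼 r, (u ⬝ᵥ g r) * (v ⬝ᵥ g r) = u ⬝ᵥ v := by
  have h : ∀ r, (u ⬝ᵥ g r) * (v ⬝ᵥ g r) = ∑ i, ∑ j, g r i * g r j * (u i * v j) := fun r => by
    rw [dotProduct, dotProduct, Finset.sum_mul_sum]
    exact Finset.sum_congr rfl fun i _ => Finset.sum_congr rfl fun j _ => by ring
  simp_rw [h, Finset.expect_sum_comm, ← Finset.expect_mul, hg.second]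
  simp [dotProduct]

theorem expect_dotProduct_sq (hg : IsotropicFamily g) (u : Fin d → ℝ) :
    𝔼 r, (u ⬝ᵥ g r) ^ 2 = u ⬝ᵥ u := by
  simp_rw [sq]
  exact hg.expect_dotProduct_mul u u

theorem expect_vecMul_sq (hg : IsotropicFamily g) (Q : Matrix (Fin d) (Fin d) ℝ) :
    𝔼 r, ∑ j, (g r ᵥ* Q) j ^ 2 = frobSq Q := by
  rw [Finset.expect_sum_comm, frobSq, Finset.sum_comm]
  refine Finset.sum_congr rfl fun j _ => ?_
  have := hg.expect_dotProduct_sq fun i => Q i j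
  simp_rw [dotProduct_comm _ (g _)] at this
  refine this.trans ?_
  simp [dotProduct, sq]

/-- Expand the square over pairs of rows of A and apply Cauchy–Schwarz to each pair; the
fourth-moment bound then factors. -/
theorem expect_norm_fourth_le (hg : IsotropicFamily g) (A : Matrix (Fin d) (Fin d) ℝ) :
    𝔼 r, ((A *ᵥ g r) ⬝ᵥ (A *ᵥ g r)) ^ 2 ≤ 3 * frobSq A ^ 2 := by
  have h1 : ∀ i j, 𝔼 r, (A i ⬝ᵥ g r) ^ 2 * (A j ⬝ᵥ g r) ^ 2 ≤
      3 * ((A i ⬝ᵥ A i) * (A j ⬝ᵥ A j)) := by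
    intro i j
    have hi := hg.fourth (A i)
    have hj := hg.fourth (A j)
    have hi0 : 0 ≤ A i ⬝ᵥ A i := Finset.sum_nonneg fun _ _ => mul_self_nonneg _
    have hj0 : 0 ≤ A j ⬝ᵥ A j := Finset.sum_nonneg fun _ _ => mul_self_nonneg _
    have hc : (𝔼 r, (A i ⬝ᵥ g r) ^ 2 * (A j ⬝ᵥ g r) ^ 2) ^ 2 ≤
        (𝔼 r, (A i ⬝ᵥ g r) ^ 4) * 𝔼 r, (A j ⬝ᵥ g r) ^ 4 := by
      have := Finset.sum_mul_sq_le_sq_mul_sq Finset.univ (fun r => (A i ⬝ᵥ g r) ^ 2)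
        (fun r => (A j ⬝ᵥ g r) ^ 2)
      simp_rw [← pow_mul] at this
      simp_rw [Fintype.expect_eq_sum_div_card]
      rw [div_pow, div_mul_div_comm, ← sq]
      exact div_le_div_of_nonneg_right this (sq_nonneg _)
    have hj4 : 0 ≤ 𝔼 r, (A j ⬝ᵥ g r) ^ 4 := Finset.expect_nonneg fun _ _ => by positivity
    refine abs_le_of_sq_le_sq' ?_ (by positivity) |>.2
    calc _ ≤ _ := hc
      _ ≤ (3 * (A i ⬝ᵥ A i) ^ 2) * (3 * (A j ⬝ᵥ A j) ^ 2) :=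
        mul_le_mul hi hj hj4 (by positivity)
      _ = _ := by ring
  have h2 : ∀ r, ((A *ᵥ g r) ⬝ᵥ (A *ᵥ g r)) ^ 2 =
      ∑ i, ∑ j, (A i ⬝ᵥ g r) ^ 2 * (A j ⬝ᵥ g r) ^ 2 := fun r => by
    rw [← Finset.sum_mul_sum, sq]
    simp [dotProduct, Matrix.mulVec, sq]
  have h3 : frobSq A = ∑ i, A i ⬝ᵥ A i := by simp [frobSq, dotProduct, sq]
  simp_rw [h2, Finset.expect_sum_comm]
  rw [h3, sq, Finset.sum_mul_sum, Finset.mul_sum]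
  simp_rw [Finset.mul_sum]
  exact Finset.sum_le_sum fun i _ => Finset.sum_le_sum fun j _ => h1 i j

end IsotropicFamily

/-- The centered rank-one matrix `A (x xᵀ - 1) A` for symmetric `A`. -/
def centeredRankOne (A : Matrix (Fin d) (Fin d) ℝ) (x : Fin d → ℝ) : Matrix (Fin d) (Fin d) ℝ :=
  Matrix.vecMulVec (A *ᵥ x) (A *ᵥ x) - A * A

theorem vecMul_centeredRankOne (A : Matrix (Fin d) (Fin d) ℝ) (x y : Fin d → ℝ) :
    y ᵥ* centeredRankOne A x = (y ⬝ᵥ A *ᵥ x) • (A *ᵥ x) - y ᵥ* (A * A) := by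
  rw [centeredRankOne, Matrix.vecMul_sub, Matrix.vecMul_vecMulVec]

namespace IsotropicFamily

variable {g : R → Fin d → ℝ} [Nonempty R] {A : Matrix (Fin d) (Fin d) ℝ}

theorem expect_centeredRankOne (hg : IsotropicFamily g) (hA : Aᵀ = A) (i j : Fin d) :
    𝔼 r, centeredRankOne A (g r) i j = 0 := by
  simp only [centeredRankOne, Matrix.sub_apply, Matrix.vecMulVec_apply, Finset.expect_sub_distrib]
  have := hg.expect_dotProduct_mul (A i) (A j)
  rw [Fintype.expect_const, sub_eq_zero]
  refine this.trans ?_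
  rw [Matrix.mul_apply]
  exact Finset.sum_congr rfl fun k _ => congrArg (A i k * ·) (congrFun₂ hA k j)

/-- A variance is at most the raw second moment. -/
theorem expect_sq_centeredRankOne_le (hg : IsotropicFamily g) (hA : Aᵀ = A) (i j : Fin d) :
    𝔼 r, centeredRankOne A (g r) i j ^ 2 ≤ 𝔼 r, ((A *ᵥ g r) i * (A *ᵥ g r) j) ^ 2 := by
  have h0 := hg.expect_centeredRankOne hA i j
  have h : ∀ r, ((A *ᵥ g r) i * (A *ᵥ g r) j) ^ 2 = centeredRankOne A (g r) i j ^ 2 +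
      centeredRankOne A (g r) i j * (2 * (A * A) i j) + (A * A) i j ^ 2 := fun r => by
    simp only [centeredRankOne, Matrix.sub_apply, Matrix.vecMulVec_apply]
    ring
  simp_rw [h, Finset.expect_add_distrib, ← Finset.expect_mul, h0, Fintype.expect_const]
  nlinarith [sq_nonneg ((A * A) i j)]

theorem expect_frobSq_centeredRankOne_le (hg : IsotropicFamily g) (hA : Aᵀ = A) :
    𝔼 r, frobSq (centeredRankOne A (g r)) ≤ 3 * frobSq A ^ 2 := by
  refine le_trans ?_ (hg.expect_norm_fourth_le A)
  simp_rw [frobSq, Finset.expect_sum_comm]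
  refine (Finset.sum_le_sum fun i _ => Finset.sum_le_sum fun j _ =>
    hg.expect_sq_centeredRankOne_le hA i j).trans_eq ?_
  simp_rw [← Finset.expect_sum_comm]
  refine Finset.expect_congr rfl fun r _ => ?_
  rw [sq, dotProduct, Finset.sum_mul_sum]
  exact Finset.sum_congr rfl fun i _ => Finset.sum_congr rfl fun j _ => by ring

/-- The second moment of a sum of independent centered rank-one matrices and a constant. -/
theorem expect_frobSq_sum_le (hg : IsotropicFamily g) (hA : Aᵀ = A) (S : Finset (Fin M))
    (B : Matrix (Fin d) (Fin d) ℝ) :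
    𝔼 ω : Fin M → R, frobSq (∑ c ∈ S, centeredRankOne A (g (ω c)) + B) ≤
      S.card * (3 * frobSq A ^ 2) + frobSq B := by
  have h : ∀ i j, 𝔼 ω : Fin M → R, (∑ c ∈ S, centeredRankOne A (g (ω c)) + B) i j ^ 2 =
      S.card * 𝔼 r, centeredRankOne A (g r) i j ^ 2 + B i j ^ 2 := fun i j => by
    rw [← expect_sq_sum_add _ (hg.expect_centeredRankOne hA i j)]
    simp [Matrix.add_apply, Matrix.sum_apply]
  have h' := hg.expect_frobSq_centeredRankOne_le hA
  simp_rw [frobSq, Finset.expect_sum_comm] at h' ⊢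
  simp_rw [h, Finset.sum_add_distrib, ← Finset.mul_sum]
  gcongr

end IsotropicFamily

end Moments

/-! ### Mean square error of the sketch identities. -/

section SketchMoments

open scoped BigOperators

variable {R : Type*} {d M : ℕ}

/-- The sum of independent centered rank-one matrices over the indices in `S`, plus `B`. -/
def centeredSum (A : Matrix (Fin d) (Fin d) ℝ) (x : Fin M → Fin d → ℝ) (S : Finset (Fin M))
    (B : Matrix (Fin d) (Fin d) ℝ) : Matrix (Fin d) (Fin d) ℝ :=
  ∑ c ∈ S, centeredRankOne A (x c) + B

theorem centeredSum_update {A : Matrix (Fin d) (Fin d) ℝ} (g : R → Fin d → ℝ) (ω : Fin M → R)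
    {S : Finset (Fin M)} {B : Matrix (Fin d) (Fin d) ℝ} {a : Fin M} (ha : a ∉ S) (r : R) :
    centeredSum A (fun c => g (Function.update ω a r c)) S B =
      centeredSum A (fun c => g (ω c)) S B := by
  unfold centeredSum
  congr 1
  exact Finset.sum_congr rfl fun c hc => by
    simp only [Function.update_of_ne (ne_of_mem_of_not_mem hc ha)]

/-- Undoing the centering lets the residuals of the sketch, computed entry by entry, be recognised
as `centeredSum` expressions. -/
theorem vecMul_centeredSum (A : Matrix (Fin d) (Fin d) ℝ) (x : Fin M → Fin d → ℝ)
    (S : Finset (Fin M)) (B : Matrix (Fin d) (Fin d) ℝ) (y : Fin d → ℝ) :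
    y ᵥ* centeredSum A x S B = ∑ c ∈ S, (y ⬝ᵥ A *ᵥ x c) • (A *ᵥ x c) -
      (S.card : ℝ) • (y ᵥ* (A * A)) + y ᵥ* B := by
  classical
  rw [centeredSum, Matrix.vecMul_add]
  congr 1
  induction S using Finset.induction_on with
  | empty => simp
  | insert c S hc ih =>
    rw [Finset.sum_insert hc, Matrix.vecMul_add, ih, Finset.sum_insert hc,
      vecMul_centeredRankOne, Finset.card_insert_of_notMem hc]
    push_cast
    module

variable [Fintype R] [Nonempty R]

namespace IsotropicFamily

variable {g : R → Fin d → ℝ} {A : Matrix (Fin d) (Fin d) ℝ}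

/-- As a ∉ S, the vector with index a is independent of the sum, and averaging over it alone turns
the left side into a squared Frobenius norm. -/
theorem expect_vecMul_centeredSum_le (hg : IsotropicFamily g) (hA : Aᵀ = A) {S : Finset (Fin M)}
    (B : Matrix (Fin d) (Fin d) ℝ) {a : Fin M} (ha : a ∉ S) :
    𝔼 ω : Fin M → R, ∑ j, (g (ω a) ᵥ* centeredSum A (fun c => g (ω c)) S B) j ^ 2 ≤
      S.card * (3 * frobSq A ^ 2) + frobSq B := by
  rw [expect_resample a]
  simp_rw [centeredSum_update g _ ha, Function.update_self, hg.expect_vecMul_sq]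
  exact hg.expect_frobSq_sum_le hA S B

theorem expect_bilin_centeredSum_le (hg : IsotropicFamily g) (hA : Aᵀ = A) {S : Finset (Fin M)}
    (B : Matrix (Fin d) (Fin d) ℝ) {a b : Fin M} (hab : a ≠ b) (ha : a ∉ S) (hb : b ∉ S) :
    𝔼 ω : Fin M → R,
        ((g (ω a) ᵥ* centeredSum A (fun c => g (ω c)) S B) ⬝ᵥ g (ω b)) ^ 2 ≤
      S.card * (3 * frobSq A ^ 2) + frobSq B := by
  rw [expect_resample b]
  simp_rw [centeredSum_update g _ hb, Function.update_self, Function.update_of_ne hab,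
    hg.expect_dotProduct_sq]
  refine le_trans (le_of_eq ?_) (hg.expect_vecMul_centeredSum_le hA B ha)
  simp [dotProduct, sq]

/-- Here the same vector stands on both sides, so it cannot be averaged out twice. With it fixed,
and p = ‖A x_a‖², the form is a sum of independent centered scalars ((A x_a)·x_c)² - p plus βp. Each
has variance at most 3p², and p² is averaged last. -/
theorem expect_quadForm_centeredSum_le (hg : IsotropicFamily g) (hA : Aᵀ = A)
    {S : Finset (Fin M)} (β : ℝ) {a : Fin M} (ha : a ∉ S) :
    𝔼 ω : Fin M → R,
        ((g (ω a) ᵥ* centeredSum A (fun c => g (ω c)) S (β • (A * A))) ⬝ᵥ g (ω a)) ^ 2 ≤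
      (3 * S.card + β ^ 2) * (3 * frobSq A ^ 2) := by
  rw [expect_resample a]
  simp_rw [centeredSum_update g _ ha, Function.update_self]
  rw [Finset.expect_comm]
  have hq : ∀ r, (g r ᵥ* (A * A)) ⬝ᵥ g r = (A *ᵥ g r) ⬝ᵥ (A *ᵥ g r) := fun r => by
    rw [← Matrix.vecMul_vecMul, ← Matrix.dotProduct_mulVec]
    nth_rewrite 1 [← hA]
    rw [Matrix.vecMul_transpose]
  have hsym : ∀ u v : Fin d → ℝ, u ⬝ᵥ A *ᵥ v = (A *ᵥ u) ⬝ᵥ v := fun u v => by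
    rw [Matrix.dotProduct_mulVec]
    nth_rewrite 1 [← hA]
    rw [Matrix.vecMul_transpose]
  have key : ∀ r, 𝔼 ω : Fin M → R,
      ((g r ᵥ* centeredSum A (fun c => g (ω c)) S (β • (A * A))) ⬝ᵥ g r) ^ 2 ≤
        (3 * S.card + β ^ 2) * ((A *ᵥ g r) ⬝ᵥ (A *ᵥ g r)) ^ 2 := by
    intro r
    set p := (A *ᵥ g r) ⬝ᵥ (A *ᵥ g r) with hp
    have hW : ∀ r', (g r ᵥ* centeredRankOne A (g r')) ⬝ᵥ g r = ((A *ᵥ g r) ⬝ᵥ g r') ^ 2 - p := by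
      intro r'
      rw [vecMul_centeredRankOne, sub_dotProduct, smul_dotProduct, hq, smul_eq_mul, hsym,
        dotProduct_comm _ (g r), hsym, sq]
    have h1 : 𝔼 r', (((A *ᵥ g r) ⬝ᵥ g r') ^ 2 - p) = 0 := by
      rw [Finset.expect_sub_distrib, hg.expect_dotProduct_sq, Fintype.expect_const, sub_self]
    have h2 : ∀ ω : Fin M → R,
        (g r ᵥ* centeredSum A (fun c => g (ω c)) S (β • (A * A))) ⬝ᵥ g r =
          ∑ c ∈ S, (((A *ᵥ g r) ⬝ᵥ g (ω c)) ^ 2 - p) + β * p := by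
      intro ω
      simp_rw [← hW]
      rw [centeredSum, Matrix.vecMul_add, add_dotProduct, Matrix.vecMul_smul, smul_dotProduct,
        hq, smul_eq_mul]
      congr 1
      rw [Matrix.vecMul_sum, sum_dotProduct]
    simp_rw [h2]
    rw [expect_sq_sum_add (fun r' => ((A *ᵥ g r) ⬝ᵥ g r') ^ 2 - p) h1]
    have h3 : 𝔼 r', (((A *ᵥ g r) ⬝ᵥ g r') ^ 2 - p) ^ 2 ≤ 3 * p ^ 2 := by
      have h4 : ∀ r', (((A *ᵥ g r) ⬝ᵥ g r') ^ 2 - p) ^ 2 =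
          ((A *ᵥ g r) ⬝ᵥ g r') ^ 4 - (((A *ᵥ g r) ⬝ᵥ g r') ^ 2 - p) * (2 * p) - p ^ 2 :=
        fun r' => by ring
      simp_rw [h4, Finset.expect_sub_distrib _ _ _, ← Finset.expect_mul, h1, Fintype.expect_const]
      nlinarith [hg.fourth (A *ᵥ g r), sq_nonneg p]
    nlinarith [mul_le_mul_of_nonneg_left h3 (Nat.cast_nonneg (α := ℝ) S.card)]
  refine (Finset.expect_le_expect fun r _ => key r).trans ?_
  rw [← Finset.mul_expect]
  exact mul_le_mul_of_nonneg_left (hg.expect_norm_fourth_le A) (by positivity)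

end IsotropicFamily

/-- The matrix of pairwise values `x_aᵀ A x_b / M` with its diagonal replaced by zero. -/
noncomputable def offDiagSketch (A : Matrix (Fin d) (Fin d) ℝ) (x : Fin M → Fin d → ℝ) :
    Matrix (Fin M) (Fin M) ℝ :=
  Matrix.of fun a b => if a = b then 0 else (x a ⬝ᵥ A *ᵥ x b) / M

/-- The matrix with rows `(A x_a)ᵀ / √M`. -/
noncomputable def rowSketch (A : Matrix (Fin d) (Fin d) ℝ) (x : Fin M → Fin d → ℝ) :
    Matrix (Fin M) (Fin d) ℝ :=
  Matrix.of fun a j => (A *ᵥ x a) j / √M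

theorem rowSketch_transpose_mul_self_sub [NeZero M] (A : Matrix (Fin d) (Fin d) ℝ)
    (x : Fin M → Fin d → ℝ) : (rowSketch A x)ᵀ * rowSketch A x - A * A =
      (M : ℝ)⁻¹ • centeredSum A x Finset.univ 0 := by
  have hM : (M : ℝ) ≠ 0 := Nat.cast_ne_zero.2 (NeZero.ne M)
  have hs : √(M : ℝ) ^ 2 = M := Real.sq_sqrt (Nat.cast_nonneg M)
  ext i j
  have h : ((rowSketch A x)ᵀ * rowSketch A x) i j = (∑ c, (A *ᵥ x c) i * (A *ᵥ x c) j) / M := by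
    rw [Matrix.mul_apply, Finset.sum_div]
    refine Finset.sum_congr rfl fun c _ => ?_
    simp only [rowSketch, Matrix.transpose_apply, Matrix.of_apply]
    rw [div_mul_div_comm, ← sq, hs]
  rw [Matrix.sub_apply, h]
  rw [centeredSum, add_zero, Matrix.smul_apply, Matrix.sum_apply, smul_eq_mul]
  simp only [centeredRankOne, Matrix.sub_apply, Matrix.vecMulVec_apply]
  rw [Finset.sum_sub_distrib, Finset.sum_const, Finset.card_univ, Fintype.card_fin, nsmul_eq_mul,
    mul_sub, inv_mul_cancel_left₀ hM, div_eq_inv_mul]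

/-- The zero diagonal removes the term c = a, so the remaining sum is independent of x_a. Only M - 1
copies of A² are then subtracted by centering; the constant -A² supplies the missing one. -/
theorem offDiagSketch_mul_rowSketch_sub [NeZero M] (A : Matrix (Fin d) (Fin d) ℝ) (hA : Aᵀ = A)
    (x : Fin M → Fin d → ℝ) (a : Fin M) (j : Fin d) :
    (offDiagSketch A x * rowSketch A x - rowSketch A x * A) a j =
      (x a ᵥ* centeredSum A x (Finset.univ.erase a) ((-1 : ℝ) • (A * A))) j / (M * √M) := by
  have hM : (M : ℝ) ≠ 0 := Nat.cast_ne_zero.2 (NeZero.ne M)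
  have hM0 : 1 ≤ M := NeZero.one_le
  have h1 : (rowSketch A x * A) a j = (x a ᵥ* (A * A)) j / √M := by
    have : rowSketch A x a = (√(M : ℝ))⁻¹ • (x a ᵥ* A) := by
      ext i
      rw [Pi.smul_apply, ← Matrix.mulVec_transpose, hA, rowSketch, Matrix.of_apply, smul_eq_mul,
        div_eq_inv_mul]
    rw [Matrix.mul_apply_eq_vecMul, this, Matrix.smul_vecMul, Matrix.vecMul_vecMul, Pi.smul_apply,
      smul_eq_mul, div_eq_inv_mul]
  have h2 : (offDiagSketch A x * rowSketch A x) a j =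
      ∑ c ∈ Finset.univ.erase a, (x a ⬝ᵥ A *ᵥ x c) / M * ((A *ᵥ x c) j / √M) := by
    rw [Matrix.mul_apply]
    refine (Finset.sum_erase Finset.univ (a := a) (by simp [offDiagSketch])).symm.trans
      (Finset.sum_congr rfl fun c hc => ?_)
    simp [offDiagSketch, rowSketch, (Finset.ne_of_mem_erase hc).symm]
  rw [Matrix.sub_apply, h1, h2, vecMul_centeredSum, Finset.card_erase_of_mem (Finset.mem_univ a)]
  simp only [Finset.card_univ, Fintype.card_fin, Pi.add_apply, Pi.sub_apply, Pi.smul_apply,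
    Finset.sum_apply, smul_eq_mul, Matrix.vecMul_smul, div_mul_div_comm, ← Finset.sum_div,
    Nat.cast_sub hM0]
  push_cast
  field_simp
  ring

/-- Zero diagonals remove c = a and c = b, leaving a sum independent of both vectors. The multiple
of A² makes up the shortfall from M: one if a = b, two otherwise. -/
theorem offDiagSketch_sq_sub [NeZero M] (A : Matrix (Fin d) (Fin d) ℝ) (hA : Aᵀ = A)
    (x : Fin M → Fin d → ℝ) (a b : Fin M) :
    (rowSketch A x * (rowSketch A x)ᵀ - offDiagSketch A x * offDiagSketch A x) a b =
      -((x a ᵥ* centeredSum A x ((Finset.univ.erase a).erase b)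
        ((((Finset.univ.erase a).erase b).card - M : ℝ) • (A * A))) ⬝ᵥ x b) / M ^ 2 := by
  have hM : (M : ℝ) ≠ 0 := Nat.cast_ne_zero.2 (NeZero.ne M)
  have hs : √(M : ℝ) ^ 2 = M := Real.sq_sqrt (Nat.cast_nonneg M)
  have hsym : ∀ v, v ᵥ* A = A *ᵥ v := fun v => by
    rw [← Matrix.mulVec_transpose, hA]
  have h1 : (rowSketch A x * (rowSketch A x)ᵀ) a b = ((x a ᵥ* (A * A)) ⬝ᵥ x b) / M := by
    rw [← Matrix.vecMul_vecMul, ← Matrix.dotProduct_mulVec, hsym, dotProduct, Finset.sum_div,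
      Matrix.mul_apply]
    refine Finset.sum_congr rfl fun i _ => ?_
    simp only [rowSketch, Matrix.transpose_apply, Matrix.of_apply]
    rw [div_mul_div_comm, ← sq, hs]
  have h2 : (offDiagSketch A x * offDiagSketch A x) a b =
      ∑ c ∈ (Finset.univ.erase a).erase b,
        ((x a ⬝ᵥ A *ᵥ x c) * ((A *ᵥ x c) ⬝ᵥ x b)) / M ^ 2 := by
    rw [Matrix.mul_apply]
    refine (Finset.sum_erase Finset.univ (a := a) (by simp [offDiagSketch])).symm.trans
      ((Finset.sum_erase _ (a := b) (by simp [offDiagSketch])).symm.trans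
        (Finset.sum_congr rfl fun c hc => ?_))
    have hcb := Finset.ne_of_mem_erase hc
    have hca := (Finset.ne_of_mem_erase (Finset.mem_of_mem_erase hc)).symm
    have : x c ⬝ᵥ A *ᵥ x b = (A *ᵥ x c) ⬝ᵥ x b := by rw [Matrix.dotProduct_mulVec, hsym]
    simp only [offDiagSketch, Matrix.of_apply, if_neg hca, if_neg hcb, this]
    ring
  rw [Matrix.sub_apply, h1, h2, vecMul_centeredSum, ← Finset.sum_div, add_dotProduct,
    sub_dotProduct, sum_dotProduct, Matrix.vecMul_smul, smul_dotProduct, smul_dotProduct]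
  simp only [smul_dotProduct, smul_eq_mul]
  field_simp
  ring

/-- The total squared error of the approximate identities `Yᵀ Y ≈ A²`, `H Y ≈ Y A` and
`Y Yᵀ ≈ H²` between a matrix and its sketches. -/
noncomputable def sketchError (A : Matrix (Fin d) (Fin d) ℝ) (x : Fin M → Fin d → ℝ) : ℝ :=
  frobSq ((rowSketch A x)ᵀ * rowSketch A x - A * A) +
  frobSq (offDiagSketch A x * rowSketch A x - rowSketch A x * A) +
  frobSq (rowSketch A x * (rowSketch A x)ᵀ - offDiagSketch A x * offDiagSketch A x)

/-- The three residuals contribute 3, 3 and 12. In the last one the M diagonal entries have a larger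
bound, but there are too few of them to change the order in M. -/
theorem IsotropicFamily.expect_sketchError_le [NeZero M] {g : R → Fin d → ℝ}
    (hg : IsotropicFamily g) {A : Matrix (Fin d) (Fin d) ℝ} (hA : Aᵀ = A) :
    𝔼 ω : Fin M → R, sketchError A (fun c => g (ω c)) ≤ 18 * frobSq A ^ 2 / M := by
  have hM0 : 1 ≤ M := NeZero.one_le
  have hM : (0 : ℝ) < M := Nat.cast_pos.2 hM0
  have hM1 : (1 : ℝ) ≤ M := by exact_mod_cast hM0
  have hs : √(M : ℝ) ^ 2 = M := Real.sq_sqrt hM.le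
  set P := frobSq A ^ 2 with hP
  have hP0 : 0 ≤ P := sq_nonneg _
  have hAA : frobSq (A * A) ≤ P := (frobSq_mul_le A A).trans_eq (sq _).symm
  have e1 : 𝔼 ω : Fin M → R, frobSq ((rowSketch A fun c => g (ω c))ᵀ *
      (rowSketch A fun c => g (ω c)) - A * A) ≤ 3 * P / M := by
    simp_rw [rowSketch_transpose_mul_self_sub, frobSq_smul, ← Finset.mul_expect]
    have := hg.expect_frobSq_sum_le hA (Finset.univ : Finset (Fin M)) 0
    refine (mul_le_mul_of_nonneg_left this (sq_nonneg _)).trans_eq ?_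
    have h0 : frobSq (0 : Matrix (Fin d) (Fin d) ℝ) = 0 := by simp [frobSq]
    rw [h0, Finset.card_univ, Fintype.card_fin, ← hP]
    field_simp
    ring
  have e2 : 𝔼 ω : Fin M → R, frobSq ((offDiagSketch A fun c => g (ω c)) *
      (rowSketch A fun c => g (ω c)) - (rowSketch A fun c => g (ω c)) * A) ≤ 3 * P / M := by
    simp_rw [frobSq, offDiagSketch_mul_rowSketch_sub A hA, div_pow, ← Finset.sum_div,
      ← Finset.expect_div]
    rw [Finset.expect_sum_comm, div_le_div_iff₀ (by positivity) hM, mul_pow, hs]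
    have h : ∀ a : Fin M, 𝔼 ω : Fin M → R, ∑ j, (g (ω a) ᵥ* centeredSum A (fun c => g (ω c))
        (Finset.univ.erase a) ((-1 : ℝ) • (A * A))) j ^ 2 ≤ 3 * M * P := fun a => by
      refine (hg.expect_vecMul_centeredSum_le hA _ (Finset.notMem_erase a _)).trans ?_
      rw [Finset.card_erase_of_mem (Finset.mem_univ a), frobSq_smul, Finset.card_univ,
        Fintype.card_fin, Nat.cast_sub hM0]
      push_cast
      nlinarith
    calc _ ≤ (∑ _a : Fin M, 3 * M * P) * M :=
          mul_le_mul_of_nonneg_right (Finset.sum_le_sum fun a _ => h a) hM.le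
      _ = _ := by simp; ring
  have e3 : 𝔼 ω : Fin M → R, frobSq ((rowSketch A fun c => g (ω c)) *
      (rowSketch A fun c => g (ω c))ᵀ - (offDiagSketch A fun c => g (ω c)) *
        (offDiagSketch A fun c => g (ω c))) ≤ 12 * P / M := by
    simp_rw [frobSq, offDiagSketch_sq_sub A hA, div_pow, ← Finset.sum_div, ← Finset.expect_div,
      neg_sq]
    simp_rw [Finset.expect_sum_comm]
    rw [div_le_div_iff₀ (by positivity) hM]
    have h : ∀ a b : Fin M, 𝔼 ω : Fin M → R, ((g (ω a) ᵥ* centeredSum A (fun c => g (ω c))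
        ((Finset.univ.erase a).erase b) ((((Finset.univ.erase a).erase b).card - M : ℝ) •
          (A * A))) ⬝ᵥ g (ω b)) ^ 2 ≤ 3 * M * P + if a = b then 9 * M * P else 0 := by
      intro a b
      by_cases hab : a = b
      · subst hab
        have hS : (Finset.univ.erase a).erase a = Finset.univ.erase a := by simp
        rw [hS, if_pos rfl]
        refine (hg.expect_quadForm_centeredSum_le hA _ (Finset.notMem_erase a _)).trans ?_
        rw [Finset.card_erase_of_mem (Finset.mem_univ a), Finset.card_univ, Fintype.card_fin,
          Nat.cast_sub hM0]
        push_cast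
        nlinarith
      · rw [if_neg hab]
        refine (hg.expect_bilin_centeredSum_le hA _ hab
          (fun h => Finset.notMem_erase a _ (Finset.mem_of_mem_erase h))
          (Finset.notMem_erase b _)).trans ?_
        have hM2 : 2 ≤ M := by
          have := a.2
          have := b.2
          have : (a : ℕ) ≠ b := fun h => hab (Fin.ext h)
          omega
        have hc : (((Finset.univ.erase a).erase b).card : ℝ) = M - 2 := by
          rw [Finset.card_erase_of_mem (by simp [Ne.symm hab]),
            Finset.card_erase_of_mem (Finset.mem_univ a), Finset.card_univ, Fintype.card_fin,
            Nat.sub_sub, Nat.cast_sub hM2]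
          norm_num
        rw [frobSq_smul, hc]
        nlinarith
    have hM3 : (M : ℝ) ^ 2 ≤ M ^ 3 := by nlinarith [sq_nonneg (M : ℝ)]
    calc _ ≤ (∑ a : Fin M, ∑ b : Fin M, (3 * M * P + if a = b then 9 * M * P else 0)) * M :=
          mul_le_mul_of_nonneg_right
            (Finset.sum_le_sum fun a _ => Finset.sum_le_sum fun b _ => h a b) hM.le
      _ = 3 * P * M ^ 4 + 9 * P * M ^ 3 := by
          simp [Finset.sum_add_distrib]
          ring
      _ ≤ _ := by
          have : (M : ℝ) ^ 3 ≤ M ^ 4 := pow_le_pow_right₀ hM1 (by norm_num)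
          nlinarith
  simp_rw [sketchError, Finset.expect_add_distrib]
  calc _ ≤ 3 * P / M + 3 * P / M + 12 * P / M := add_le_add (add_le_add e1 e2) e3
    _ = _ := by ring

end SketchMoments

/-! ### Random sign vectors and Markov's inequality. -/

section Rademacher

open scoped BigOperators

/-- The vectors with entries `±1`, indexed by Boolean vectors. -/
def signVector {d : ℕ} (r : Fin d → Bool) (i : Fin d) : ℝ := if r i then 1 else -1

theorem signVector_update_self {d : ℕ} (r : Fin d → Bool) (c : Fin d) (b : Bool) :
    signVector (Function.update r c b) c = if b then 1 else -1 := by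
  rw [signVector, Function.update_self]

theorem signVector_update_of_ne {d : ℕ} (r : Fin d → Bool) {c i : Fin d} (h : i ≠ c) (b : Bool) :
    signVector (Function.update r c b) i = signVector r i := by
  rw [signVector, signVector, Function.update_of_ne h]

theorem expect_bool (f : Bool → ℝ) : 𝔼 b, f b = (f true + f false) / 2 := by
  rw [Fintype.expect_eq_sum_div_card]
  simp

theorem expect_sq_sum_signVector {d : ℕ} (u : Fin d → ℝ) (S : Finset (Fin d)) :
    𝔼 r : Fin d → Bool, (∑ i ∈ S, u i * signVector r i) ^ 2 = ∑ i ∈ S, u i ^ 2 := by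
  induction S using Finset.induction_on with
  | empty => simp
  | insert c S hc ih =>
    rw [expect_resample c]
    have h : ∀ (r : Fin d → Bool) b, ∑ i ∈ S, u i * signVector (Function.update r c b) i =
        ∑ i ∈ S, u i * signVector r i := fun r b => Finset.sum_congr rfl fun i hi => by
      rw [signVector_update_of_ne r (ne_of_mem_of_not_mem hi hc)]
    simp_rw [Finset.sum_insert hc, h, expect_bool, ← ih]
    simp only [signVector_update_self, Bool.false_eq_true, if_true, if_false]
    rw [← Fintype.expect_const (ι := Fin d → Bool) (u c ^ 2), ← Finset.expect_add_distrib]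
    exact Finset.expect_congr rfl fun r _ => by ring

theorem expect_fourth_sum_signVector_le {d : ℕ} (u : Fin d → ℝ) (S : Finset (Fin d)) :
    𝔼 r : Fin d → Bool, (∑ i ∈ S, u i * signVector r i) ^ 4 ≤ 3 * (∑ i ∈ S, u i ^ 2) ^ 2 := by
  induction S using Finset.induction_on with
  | empty => simp
  | insert c S hc ih =>
    rw [expect_resample c]
    have h : ∀ (r : Fin d → Bool) b, ∑ i ∈ S, u i * signVector (Function.update r c b) i =
        ∑ i ∈ S, u i * signVector r i := fun r b => Finset.sum_congr rfl fun i hi => by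
      rw [signVector_update_of_ne r (ne_of_mem_of_not_mem hi hc)]
    simp_rw [Finset.sum_insert hc, h, expect_bool]
    simp only [signVector_update_self, Bool.false_eq_true, if_true, if_false]
    have h2 := expect_sq_sum_signVector u S
    -- Averaging over one sign removes the odd powers. With T the previous sum of squares, u⁴ + 6u²T
    -- + 3T² ≤ 3(u² + T)² closes the induction.
    have h4 : ∀ t : ℝ, ((u c * 1 + t) ^ 4 + (u c * -1 + t) ^ 4) / 2 =
        u c ^ 4 + 6 * u c ^ 2 * t ^ 2 + t ^ 4 := fun t => by ring
    simp_rw [h4, Finset.expect_add_distrib, ← Finset.mul_expect, h2, Fintype.expect_const]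
    nlinarith [sq_nonneg (u c ^ 2)]

theorem isotropicFamily_signVector (d : ℕ) :
    IsotropicFamily (signVector : (Fin d → Bool) → Fin d → ℝ) where
  second i j := by
    by_cases h : i = j
    · subst h
      have : ∀ r : Fin d → Bool, signVector r i * signVector r i = 1 := fun r => by
        unfold signVector
        split_ifs <;> norm_num
      simp [this]
    · rw [if_neg h, expect_resample i]
      refine Finset.expect_eq_zero fun r _ => ?_
      rw [expect_bool]
      simp [signVector_update_self, signVector_update_of_ne r (Ne.symm h)]
  fourth u := by
    have := expect_fourth_sum_signVector_le u Finset.univ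
    simpa [dotProduct, sq] using this

/-- Markov's inequality for the uniform distribution on a finite type. -/
theorem le_uniformOn_real_of_expect_le {Ω : Type*} [Fintype Ω] [Nonempty Ω] [MeasurableSpace Ω]
    [MeasurableSingletonClass Ω] {X : Ω → ℝ} (hX : ∀ ω, 0 ≤ X ω) {θ p : ℝ} (hθ : 0 ≤ θ) (hp : 0 ≤ p)
    (h : 𝔼 ω, X ω ≤ p * θ) :
    1 - p ≤ (ProbabilityTheory.uniformOn (Set.univ : Set Ω)).real {ω | X ω ≤ θ} := by
  classical
  have : IsProbabilityMeasure (ProbabilityTheory.uniformOn (Set.univ : Set Ω)) :=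
    ProbabilityTheory.isProbabilityMeasure_uniformOn Set.finite_univ Set.univ_nonempty
  have hc : (0 : ℝ) < Fintype.card Ω := Nat.cast_pos.2 Fintype.card_pos
  -- The threshold 0 does occur, for the zero matrix; then X vanishes identically.
  rcases hθ.eq_or_lt with rfl | hθ
  · rw [mul_zero, Fintype.expect_eq_sum_div_card, div_le_iff₀ hc, zero_mul] at h
    have h0 := (Finset.sum_eq_zero_iff_of_nonneg fun ω _ => hX ω).1
      (le_antisymm h (Finset.sum_nonneg fun ω _ => hX ω))
    have hs : {ω | X ω ≤ 0} = Set.univ := Set.eq_univ_of_forall fun ω => (h0 ω (by simp)).le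
    rw [hs, probReal_univ]
    linarith
  have h1 : (ProbabilityTheory.uniformOn (Set.univ : Set Ω)).real {ω | X ω ≤ θ}ᶜ =
      (Finset.univ.filter fun ω => θ < X ω).card / Fintype.card Ω := by
    have hs : {ω | X ω ≤ θ}ᶜ = ((Finset.univ.filter fun ω => θ < X ω : Finset Ω) : Set Ω) := by
      ext ω
      simp
    rw [hs, Measure.real, ProbabilityTheory.uniformOn_univ, Measure.count_apply_finset]
    simp
  rw [probReal_compl_eq_one_sub (Set.toFinite _).measurableSet] at h1
  have h2 : (Finset.univ.filter fun ω => θ < X ω).card * θ ≤ ∑ ω, X ω := by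
    rw [← nsmul_eq_mul]
    refine (Finset.card_nsmul_le_sum _ X θ fun ω hω => (Finset.mem_filter.1 hω).2.le).trans ?_
    exact Finset.sum_le_sum_of_subset_of_nonneg (Finset.filter_subset _ _) fun ω _ _ => hX ω
  rw [Fintype.expect_eq_sum_div_card, div_le_iff₀ hc] at h
  have h3 : ((Finset.univ.filter fun ω => θ < X ω).card : ℝ) / Fintype.card Ω ≤ p := by
    rw [div_le_iff₀ hc]
    nlinarith
  linarith

end Rademacher

/-! ### Comparing signed spectra of matrices of different sizes. -/

section SignedTerms

open scoped InnerProductSpace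

/-- The nonnegative and then the nonpositive terms of a sequence, both sorted by decreasing
magnitude if the sequence is decreasing, and continued by zeros. -/
noncomputable def signedTerm {n : ℕ} (l : Fin n → ℝ) : ℕ ⊕ ℕ → ℝ :=
  Sum.elim (posTerm l) fun j => -posTerm (fun i => -l i.rev) j

theorem norm_toEuclideanLin_sq_le {m n : ℕ} (B : Matrix (Fin m) (Fin n) ℝ)
    (v : EuclideanSpace ℝ (Fin n)) : ‖B.toEuclideanLin v‖ ^ 2 ≤ frobSq B * ‖v‖ ^ 2 := by
  have := dotProduct_mulVec_self_le B v.ofLp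
  rw [EuclideanSpace.real_norm_sq_eq, EuclideanSpace.real_norm_sq_eq]
  simpa [dotProduct, sq, Matrix.toLpLin_apply] using this

theorem norm_toEuclideanLin_le {m n : ℕ} {B : Matrix (Fin m) (Fin n) ℝ} {η : ℝ} (hη : 0 ≤ η)
    (h : frobSq B ≤ η ^ 2) (v : EuclideanSpace ℝ (Fin n)) :
    ‖B.toEuclideanLin v‖ ≤ η * ‖v‖ := by
  refine abs_le_of_sq_le_sq' ?_ (by positivity) |>.2
  rw [mul_pow]
  exact (norm_toEuclideanLin_sq_le B v).trans (mul_le_mul_of_nonneg_right h (sq_nonneg _))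

theorem Matrix.toEuclideanLin_mul_apply {m n p : ℕ} (B : Matrix (Fin m) (Fin n) ℝ)
    (C : Matrix (Fin n) (Fin p) ℝ) (v : EuclideanSpace ℝ (Fin p)) :
    (B * C).toEuclideanLin v = B.toEuclideanLin (C.toEuclideanLin v) := by
  simp [Matrix.toLpLin_apply]

theorem Matrix.inner_toEuclideanLin_toEuclideanLin {m n p : ℕ} (B : Matrix (Fin m) (Fin n) ℝ)
    (C : Matrix (Fin m) (Fin p) ℝ) (u : EuclideanSpace ℝ (Fin n)) (v : EuclideanSpace ℝ (Fin p)) :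
    ⟪B.toEuclideanLin u, C.toEuclideanLin v⟫_ℝ = ⟪u, (Bᵀ * C).toEuclideanLin v⟫_ℝ := by
  rw [Matrix.toEuclideanLin_mul_apply, ← Matrix.conjTranspose_eq_transpose_of_trivial,
    Matrix.toEuclideanLin_conjTranspose_eq_adjoint, LinearMap.adjoint_inner_right]

variable {n m n' m' : ℕ} {A : Matrix (Fin n) (Fin n) ℝ} {H : Matrix (Fin m) (Fin m) ℝ}
  {l : Fin n' → ℝ} {l' : Fin m' → ℝ}

/-- The Frobenius norm dominates the operator norm, so squared errors δ⁴ become operator errors δ².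
-/
theorem posTerm_le_add_of_frobSq_le (hA : A.IsHermitian) (hH : H.IsHermitian)
    (b : OrthonormalBasis (Fin n') ℝ (EuclideanSpace ℝ (Fin n)))
    (b' : OrthonormalBasis (Fin m') ℝ (EuclideanSpace ℝ (Fin m)))
    (hb : ∀ i, A.toEuclideanLin (b i) = l i • b i)
    (hb' : ∀ i, H.toEuclideanLin (b' i) = l' i • b' i) (hl : Antitone l) (hl' : Antitone l')
    (Y : Matrix (Fin m) (Fin n) ℝ) {δ : ℝ} (hδ : 0 ≤ δ) (hY : frobSq (Yᵀ * Y - A * A) ≤ δ ^ 4)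
    (hHY : frobSq (H * Y - Y * A) ≤ δ ^ 4) (j : ℕ) : posTerm l j ≤ posTerm l' j + 2 * δ := by
  have hδ4 : δ ^ 4 = (δ ^ 2) ^ 2 := by ring
  rw [hδ4] at hY hHY
  refine posTerm_le_add_of_intertwining (Matrix.isSymmetric_toEuclideanLin_iff.2 hA)
    (Matrix.isSymmetric_toEuclideanLin_iff.2 hH) b b' hb hb' hl hl' Y.toEuclideanLin hδ ?_ ?_ j
  · intro u v
    have hAT : Aᵀ = A := by rw [← Matrix.conjTranspose_eq_transpose_of_trivial, hA.eq]
    rw [Matrix.inner_toEuclideanLin_toEuclideanLin, Matrix.inner_toEuclideanLin_toEuclideanLin,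
      hAT, ← inner_sub_right, ← LinearMap.sub_apply, ← map_sub]
    refine (abs_real_inner_le_norm _ _).trans ?_
    have := mul_le_mul_of_nonneg_left (norm_toEuclideanLin_le (sq_nonneg δ) hY v) (norm_nonneg u)
    linarith
  · intro u
    rw [← Matrix.toEuclideanLin_mul_apply, ← Matrix.toEuclideanLin_mul_apply,
      ← LinearMap.sub_apply, ← map_sub]
    exact norm_toEuclideanLin_le (sq_nonneg δ) hHY u

/-- The sorted list `eigenvalues₀` is indexed by `Fin (Fintype.card (Fin n))`, which is why n' and
m' are kept apart from n and m. -/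
theorem Matrix.IsHermitian.exists_eigenbasis (hA : A.IsHermitian) :
    ∃ b : OrthonormalBasis (Fin (Fintype.card (Fin n))) ℝ (EuclideanSpace ℝ (Fin n)),
      ∀ i, A.toEuclideanLin (b i) = hA.eigenvalues₀ i • b i :=
  ⟨(Matrix.isSymmetric_toEuclideanLin_iff.mpr hA).eigenvectorBasis finrank_euclideanSpace,
    fun i => LinearMap.IsSymmetric.apply_eigenvectorBasis _ _ i⟩

theorem neg_rev_eigenbasis {b : OrthonormalBasis (Fin n') ℝ (EuclideanSpace ℝ (Fin n))}
    (hb : ∀ i, A.toEuclideanLin (b i) = l i • b i) (i : Fin n') :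
    (-A).toEuclideanLin (b.reindex Fin.revPerm i) = -l i.rev • b.reindex Fin.revPerm i := by
  simp [hb]

theorem antitone_neg_rev (hl : Antitone l) : Antitone fun i : Fin n' => -l i.rev :=
  fun _ _ h => neg_le_neg (hl (Fin.rev_le_rev.2 h))

theorem frobSq_transpose {m n : ℕ} (B : Matrix (Fin m) (Fin n) ℝ) : frobSq Bᵀ = frobSq B :=
  Finset.sum_comm

theorem frobSq_neg {m n : ℕ} (B : Matrix (Fin m) (Fin n) ℝ) : frobSq (-B) = frobSq B := by
  simp [frobSq]

/-- The sorted signed eigenvalues of two symmetric matrices are close if some matrix approximately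
intertwines them and is approximately a polar factor for both. -/
theorem abs_signedTerm_sub_le_of_frobSq_le (hA : A.IsHermitian) (hH : H.IsHermitian)
    (Y : Matrix (Fin m) (Fin n) ℝ) {δ : ℝ} (hδ : 0 ≤ δ) (hY : frobSq (Yᵀ * Y - A * A) ≤ δ ^ 4)
    (hHY : frobSq (H * Y - Y * A) ≤ δ ^ 4) (hY' : frobSq (Y * Yᵀ - H * H) ≤ δ ^ 4) (x : ℕ ⊕ ℕ) :
    |signedTerm hA.eigenvalues₀ x - signedTerm hH.eigenvalues₀ x| ≤ 2 * δ := by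
  obtain ⟨b, hb⟩ := hA.exists_eigenbasis
  obtain ⟨b', hb'⟩ := hH.exists_eigenbasis
  have hl := hA.eigenvalues₀_antitone
  have hl' := hH.eigenvalues₀_antitone
  have hAT : Aᵀ = A := by rw [← Matrix.conjTranspose_eq_transpose_of_trivial, hA.eq]
  have hHT : Hᵀ = H := by rw [← Matrix.conjTranspose_eq_transpose_of_trivial, hH.eq]
  -- Transposition exchanges the roles of A and H; negating both turns negative eigenvalues into
  -- positive ones.
  have e1 : frobSq (A * Yᵀ - Yᵀ * H) ≤ δ ^ 4 := by
    rw [← frobSq_neg, ← frobSq_transpose]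
    simpa [Matrix.transpose_mul, hAT, hHT] using hHY
  have e2 : frobSq (-H * Y - Y * -A) ≤ δ ^ 4 := by
    rw [← frobSq_neg]
    simpa [sub_eq_add_neg, add_comm] using hHY
  have e3 : frobSq (-A * Yᵀ - Yᵀ * -H) ≤ δ ^ 4 := by
    rw [← frobSq_neg]
    simpa [sub_eq_add_neg, add_comm] using e1
  rcases x with j | j <;> simp only [signedTerm, Sum.elim_inl, Sum.elim_inr] <;> rw [abs_le]
  · have h1 := posTerm_le_add_of_frobSq_le hA hH b b' hb hb' hl hl' Y hδ hY hHY j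
    have h2 := posTerm_le_add_of_frobSq_le hH hA b' b hb' hb hl' hl Yᵀ hδ (by simpa using hY') e1 j
    constructor <;> linarith
  · have h1 := posTerm_le_add_of_frobSq_le hA.neg hH.neg _ _ (neg_rev_eigenbasis hb)
      (neg_rev_eigenbasis hb') (antitone_neg_rev hl) (antitone_neg_rev hl') Y hδ
      (by simpa using hY) e2 j
    have h2 := posTerm_le_add_of_frobSq_le hH.neg hA.neg _ _ (neg_rev_eigenbasis hb')
      (neg_rev_eigenbasis hb) (antitone_neg_rev hl') (antitone_neg_rev hl) Yᵀ hδ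
      (by simpa using hY') e3 j
    constructor <;> linarith

/-- The sorted signed eigenvalues are Lipschitz in the Frobenius norm. -/
theorem abs_signedTerm_sub_le {A' : Matrix (Fin n) (Fin n) ℝ} (hA : A.IsHermitian)
    (hA' : A'.IsHermitian) (x : ℕ ⊕ ℕ) :
    |signedTerm hA.eigenvalues₀ x - signedTerm hA'.eigenvalues₀ x| ≤ √(frobSq (A - A')) := by
  obtain ⟨b, hb⟩ := hA.exists_eigenbasis
  obtain ⟨b', hb'⟩ := hA'.exists_eigenbasis
  have hl := hA.eigenvalues₀_antitone
  have hl' := hA'.eigenvalues₀_antitone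
  have hn : ∀ {C D : Matrix (Fin n) (Fin n) ℝ}, frobSq (C - D) = frobSq (A - A') →
      ∀ v, ‖C.toEuclideanLin v - D.toEuclideanLin v‖ ≤ √(frobSq (A - A')) * ‖v‖ := by
    intro C D h v
    rw [← LinearMap.sub_apply, ← map_sub]
    exact norm_toEuclideanLin_le (Real.sqrt_nonneg _)
      (by rw [Real.sq_sqrt (frobSq_nonneg _), h]) v
  have e1 : frobSq (A' - A) = frobSq (A - A') := by rw [← frobSq_neg, neg_sub]
  have e2 : frobSq (-A - -A') = frobSq (A - A') := by rw [← frobSq_neg]; congr 1; abel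
  have e3 : frobSq (-A' - -A) = frobSq (A - A') := by congr 1; abel
  have s : ∀ {C : Matrix (Fin n) (Fin n) ℝ}, C.IsHermitian → C.toEuclideanLin.IsSymmetric :=
    fun h => Matrix.isSymmetric_toEuclideanLin_iff.2 h
  rcases x with j | j <;> simp only [signedTerm, Sum.elim_inl, Sum.elim_inr] <;> rw [abs_le]
  · have h1 := posTerm_le_add_of_norm_sub_le (s hA) (s hA') b b' hb hb' hl hl' (hn rfl)
      (Real.sqrt_nonneg _) j
    have h2 := posTerm_le_add_of_norm_sub_le (s hA') (s hA) b' b hb' hb hl' hl (hn e1)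
      (Real.sqrt_nonneg _) j
    constructor <;> linarith
  · have h1 := posTerm_le_add_of_norm_sub_le (s hA.neg) (s hA'.neg) _ _ (neg_rev_eigenbasis hb)
      (neg_rev_eigenbasis hb') (antitone_neg_rev hl) (antitone_neg_rev hl') (hn e2)
      (Real.sqrt_nonneg _) j
    have h2 := posTerm_le_add_of_norm_sub_le (s hA'.neg) (s hA.neg) _ _ (neg_rev_eigenbasis hb')
      (neg_rev_eigenbasis hb) (antitone_neg_rev hl') (antitone_neg_rev hl) (hn e3)
      (Real.sqrt_nonneg _) j
    constructor <;> linarith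

end SignedTerms

/-! ### Selecting the largest values. -/

section TopSelection

/-- The embedding `e` picks out indices where `c` is largest in magnitude. -/
def SelectsLargest {X : Type*} {k : ℕ} (c : X → ℝ) (e : Fin k ↪ X) : Prop :=
  ∀ x, x ∉ Set.range e → ∀ i, |c x| ≤ |c (e i)|

theorem exists_selectsLargest {X : Type*} [Fintype X] {k : ℕ} (hk : k ≤ Fintype.card X)
    (c : X → ℝ) : ∃ e : Fin k ↪ X, SelectsLargest c e := by
  let φ := Fintype.equivFin X
  let f : Fin (Fintype.card X) → ℝ := fun j => -|c (φ.symm j)|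
  have hs : Monotone (f ∘ Tuple.sort f) := Tuple.monotone_sort f
  refine ⟨(Fin.castLEEmb hk).trans ((Tuple.sort f).trans φ.symm).toEmbedding, fun x hx i => ?_⟩
  have hj : k ≤ ((Tuple.sort f).symm (φ x) : ℕ) := by
    by_contra! h
    exact hx ⟨⟨_, h⟩, by simp⟩
  have hle : Fin.castLE hk i ≤ (Tuple.sort f).symm (φ x) :=
    Fin.le_def.2 (le_trans i.2.le hj)
  have := hs hle
  simp only [Function.comp_apply, Equiv.apply_symm_apply, Equiv.symm_apply_apply, f,
    neg_le_neg_iff] at this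
  simpa using this

/-- Take the first admissible embedding in a fixed enumeration. Admissibility is a closed condition
on c, being made of non-strict inequalities, so this choice is Borel. -/
theorem exists_measurable_selection {X : Type*} [Fintype X] {k : ℕ} (hk : k ≤ Fintype.card X) :
    ∃ sel : (X → ℝ) → Fin k → ℝ, Measurable sel ∧
      ∀ c, ∃ e : Fin k ↪ X, SelectsLargest c e ∧ sel c = c ∘ e := by
  classical
  obtain ⟨e₀, -⟩ := exists_selectsLargest hk fun _ => 0
  have : Nonempty (Fin k ↪ X) := ⟨e₀⟩
  obtain ⟨enum, henum⟩ := exists_surjective_nat (Fin k ↪ X)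
  have h : ∀ c : X → ℝ, ∃ n, SelectsLargest c (enum n) := fun c => by
    obtain ⟨e, he⟩ := exists_selectsLargest hk c
    obtain ⟨n, rfl⟩ := henum e
    exact ⟨n, he⟩
  refine ⟨fun c => c ∘ enum (Nat.find (h c)), ?_, fun c => ⟨_, Nat.find_spec (h c), rfl⟩⟩
  refine Measurable.find (f := fun n (c : X → ℝ) => c ∘ enum n)
    (p := fun n c => SelectsLargest c (enum n)) (fun n => ?_) (fun n => ?_) h
  · exact measurable_pi_lambda _ fun i => measurable_pi_apply _
  · refine IsClosed.measurableSet ?_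
    simp only [SelectsLargest, Set.ofPred_forall]
    exact isClosed_iInter fun x => isClosed_iInter fun _ => isClosed_iInter fun i =>
      isClosed_le (by fun_prop) (by fun_prop)

/-- If `c'` is uniformly close to `c`, and `c` consists of the terms of `lam` and zeros, then the
largest terms of `c'` are accurate estimates of the largest terms of `lam`. -/
theorem accurateTopEigenvalues_of_abs_sub_le {X : Type*} {d k : ℕ} (hk : 1 ≤ k) (hkd : k ≤ d)
    {ε F η : ℝ} {lam : Fin d → ℝ} (hlam : Antitone fun i => |lam i|) {c c' : X → ℝ}
    (f : Fin d ↪ X) (hf : ∀ i, c (f i) = lam i) (hc : ∀ x, x ∉ Set.range f → c x = 0)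
    (hη : ∀ x, |c x - c' x| ≤ η) (h3 : 3 * η ≤ ε * F) (h0 : ε * F = 0 → ∀ i, lam i = 0)
    {e : Fin k ↪ X} (he : SelectsLargest c' e) :
    AccurateTopEigenvalues hk hkd ε F lam (c' ∘ e) := by
  classical
  set kk : Fin d := ⟨k - 1, by omega⟩ with hkk
  have hη0 : 0 ≤ η := (abs_nonneg _).trans (hη (e ⟨0, hk⟩))
  have hdiff : ∀ x, |c x| - η ≤ |c' x| ∧ |c' x| ≤ |c x| + η := fun x => by
    have h1 := (abs_sub_abs_le_abs_sub (c x) (c' x)).trans (hη x)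
    have h2 := (abs_sub_abs_le_abs_sub (c' x) (c x)).trans (abs_sub_comm (c x) _ ▸ hη x)
    constructor <;> linarith
  have hcx : ∀ x, c x = 0 ∨ ∃ i, f i = x ∧ lam i = c x := fun x => by
    by_cases hx : x ∈ Set.range f
    · obtain ⟨i, rfl⟩ := hx
      exact Or.inr ⟨i, rfl, (hf i).symm⟩
    · exact Or.inl (hc x hx)
  have htop : ∀ i : Fin k, |lam kk| ≤ |lam (Fin.castLE hkd i)| := fun i =>
    hlam (Fin.le_def.2 (by simp [hkk]; omega))
  -- Either the selected indices are exactly those of the top k terms, or some top term was passed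
  -- over and every selected value is at least as large as its perturbed value.
  have hlow : ∀ i, |lam kk| - η ≤ |c' (e i)| := by
    intro i
    by_cases hall : ∀ i' : Fin k, f (Fin.castLE hkd i') ∈ Set.range e
    · choose τ hτ using hall
      have hτi : Function.Injective τ := fun a b hab => by
        have := (hτ a).symm.trans ((congrArg e hab).trans (hτ b))
        exact Fin.castLE_injective hkd (f.injective this)
      obtain ⟨i', rfl⟩ := (Finite.injective_iff_surjective.1 hτi) i
      rw [hτ i']
      have := (hdiff (f (Fin.castLE hkd i'))).1
      rw [hf] at this
      linarith [htop i']
    · push Not at hall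
      obtain ⟨i', hi'⟩ := hall
      have h1 := he _ hi' i
      have h2 := (hdiff (f (Fin.castLE hkd i'))).1
      rw [hf] at h2
      linarith [htop i']
  refine ⟨?_, fun i => ?_⟩
  -- The strict inequalities below need εF > 0; otherwise all terms vanish and any permutation
  -- works.
  · rcases (show 0 ≤ ε * F by linarith).eq_or_lt with hθ | hθ
    · refine ⟨1, fun i _ => ?_⟩
      have hl := h0 hθ.symm
      have hz : c (e i) = 0 := by
        rcases hcx (e i) with h | ⟨j, -, h⟩
        · exact h
        · rw [← h, hl]
      have := hη (e i)
      rw [hz, zero_sub, abs_neg] at this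
      simp only [Equiv.Perm.coe_one, id, Function.comp_apply, hl, sub_zero]
      linarith
    -- If a separated term were passed over, all k selected positions would carry terms of magnitude
    -- above |λ_k|, but only the first k - 1 terms can be that large.
    · have hmem : ∀ i : Fin k, |lam kk| + 2 * ε * F ≤ |lam (Fin.castLE hkd i)| →
          f (Fin.castLE hkd i) ∈ Set.range e := by
        intro i hi
        by_contra hx
        have h1 := (hdiff (f (Fin.castLE hkd i))).1
        rw [hf] at h1
        have h2 : ∀ i', ∃ j : Fin (k - 1), f ⟨j, by omega⟩ = e i' := by
          intro i'
          have h3 := he _ hx i'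
          have h4 := (hdiff (e i')).2
          have h5 : |lam kk| < |c (e i')| := by nlinarith
          rcases hcx (e i') with h | ⟨j, hj, h⟩
          · rw [h, abs_zero] at h5
            exact absurd h5 (abs_nonneg _).not_gt
          · have hjk : j < kk := by
              by_contra! hle
              have := hlam hle
              simp only at this
              rw [← h] at h5
              linarith
            exact ⟨⟨j, Fin.lt_def.1 hjk⟩, hj⟩
        choose τ hτ using h2
        have hτi : Function.Injective τ := fun a b hab => by
          refine e.injective ?_
          rw [← hτ, ← hτ, hab]
        have := Fintype.card_le_of_injective τ hτi
        simp only [Fintype.card_fin] at this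
        omega
      let s : Finset (Fin k) :=
        Finset.univ.filter fun i => |lam kk| + 2 * ε * F ≤ |lam (Fin.castLE hkd i)|
      let τ : Fin k → Fin k := fun i =>
        if h : f (Fin.castLE hkd i) ∈ Set.range e then h.choose else i
      have hτ : ∀ i ∈ s, e (τ i) = f (Fin.castLE hkd i) := fun i hi => by
        have h := hmem i (Finset.mem_filter.1 hi).2
        simp only [τ, dif_pos h]
        exact h.choose_spec
      have hτi : Set.InjOn τ s := fun a ha b hb hab => by
        have := (hτ a ha).symm.trans ((congrArg e hab).trans (hτ b hb))
        exact Fin.castLE_injective hkd (f.injective this)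
      obtain ⟨σ, hσ⟩ := Finset.exists_equiv_extend_of_card_eq (t := (Finset.univ : Finset (Fin k)))
        (by simp) (Finset.subset_univ _) hτi
      refine ⟨σ.trans (Equiv.subtypeUnivEquiv fun x => Finset.mem_univ x), fun i hi => ?_⟩
      have hs : i ∈ s := Finset.mem_filter.2 ⟨Finset.mem_univ _, hi⟩
      have h1 : (σ.trans (Equiv.subtypeUnivEquiv fun x => Finset.mem_univ x)) i = τ i := hσ i hs
      rw [h1, Function.comp_apply, hτ i hs, abs_sub_comm, ← hf]
      linarith [hη (f (Fin.castLE hkd i))]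
  · have h1 := hη (e i)
    have h2 := hlow i
    have h3 := hdiff (e i)
    rw [abs_sub_comm] at h1
    rcases hcx (e i) with h | ⟨j, -, h⟩
    -- A selected padding zero has |c'| ≤ η, hence |λ_k| ≤ 2η, and λ_k itself is within 3η. This is
    -- where the factor 3 in `h3` is used in full.
    · refine ⟨kk, by linarith, ?_⟩
      rw [h, abs_zero] at h3
      have := abs_sub (c' (e i)) (lam kk)
      simp only [Function.comp_apply]
      linarith
    · refine ⟨j, by rw [h]; linarith, ?_⟩
      rw [h]
      simp only [Function.comp_apply]
      linarith

/-- The signed terms of a sequence consist of its terms and zeros. -/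
theorem exists_embedding_signedTerm {d n N : ℕ} (hN : n ≤ N) (l : Fin n → ℝ) (π : Fin d ≃ Fin n) :
    ∃ f : Fin d ↪ Fin N ⊕ Fin N,
      (∀ i, signedTerm l (Sum.map Fin.val Fin.val (f i)) = l (π i)) ∧
      ∀ x, x ∉ Set.range f → signedTerm l (Sum.map Fin.val Fin.val x) = 0 := by
  classical
  -- Zero terms are sent to the right summand; the slots left unused hold truncated values, which
  -- are 0.
  let f : Fin d → Fin N ⊕ Fin N := fun i =>
    if 0 < l (π i) then Sum.inl (Fin.castLE hN (π i)) else Sum.inr (Fin.castLE hN (π i).rev)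
  have hf : Function.Injective f := by
    intro a b hab
    simp only [f] at hab
    split_ifs at hab
    · exact π.injective (Fin.castLE_injective hN (Sum.inl_injective hab))
    · exact π.injective (Fin.rev_injective (Fin.castLE_injective hN (Sum.inr_injective hab)))
  refine ⟨⟨f, hf⟩, fun i => ?_, fun x hx => ?_⟩
  · simp only [Function.Embedding.coeFn_mk, f]
    split_ifs with h
    · simp [signedTerm, posTerm, h.le]
    · have h' := not_lt.1 h
      have hlt : n - (π i + 1 : ℕ) < n := by have := (π i).2; omega
      have hrev : (⟨n - (π i + 1 : ℕ), hlt⟩ : Fin n).rev = π i := by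
        ext
        have := (π i).2
        simp only [Fin.val_rev]
        omega
      simp [signedTerm, posTerm, hlt, hrev, h']
  · rcases x with j | j
    · by_cases hj : (j : ℕ) < n
      · by_cases hp : 0 < l ⟨j, hj⟩
        · exact absurd ⟨π.symm ⟨j, hj⟩, by simp [f, hp]⟩ hx
        · simp [signedTerm, posTerm, hj, not_lt.1 hp]
      · simp [signedTerm, posTerm, hj]
    · by_cases hj : (j : ℕ) < n
      · by_cases hp : 0 < l (Fin.rev ⟨j, hj⟩)
        · simp [signedTerm, posTerm, hj, hp.le]
        · refine absurd ⟨π.symm (Fin.rev ⟨j, hj⟩), ?_⟩ hx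
          simp only [Function.Embedding.coeFn_mk, f, Equiv.apply_symm_apply, if_neg hp, Fin.rev_rev]
          rfl
      · simp [signedTerm, posTerm, hj]

end TopSelection

/-! ### The algorithm, its measurability and its guarantee. -/

section Algorithm

open scoped BigOperators

/-- The symmetric matrix with zero diagonal computed from the answers to all pairwise queries. -/
noncomputable def answerMatrix (M : ℕ) (ans : Fin (M * M) → ℝ) : Matrix (Fin M) (Fin M) ℝ :=
  -- Averaging the two orders makes the matrix symmetric for every answer vector, so the output is
  -- defined on the whole answer space.
  Matrix.of fun a b =>
    if a = b then 0 else (ans (finProdFinEquiv (a, b)) + ans (finProdFinEquiv (b, a))) / (2 * M)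

theorem answerMatrix_isHermitian (M : ℕ) (ans : Fin (M * M) → ℝ) :
    (answerMatrix M ans).IsHermitian := by
  ext a b
  simp only [answerMatrix, Matrix.conjTranspose_apply, Matrix.of_apply, star_trivial,
    eq_comm (a := b), add_comm]

/-- The sorted signed eigenvalues of the answer matrix, listed up to index `N`. -/
noncomputable def sketchSpectrum (M N : ℕ) (ans : Fin (M * M) → ℝ) (x : Fin N ⊕ Fin N) : ℝ :=
  signedTerm (answerMatrix_isHermitian M ans).eigenvalues₀ (Sum.map Fin.val Fin.val x)

/-- Weyl's inequality gives continuity of the sorted eigenvalues, hence Borel measurability of the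
output. -/
theorem continuous_sketchSpectrum (M N : ℕ) : Continuous (sketchSpectrum M N) := by
  refine continuous_pi fun x => continuous_iff_continuousAt.2 fun ans₀ => ?_
  rw [ContinuousAt, tendsto_iff_dist_tendsto_zero]
  have hc : Continuous fun ans => √(frobSq (answerMatrix M ans - answerMatrix M ans₀)) := by
    unfold frobSq
    refine Real.continuous_sqrt.comp (continuous_finsetSum _ fun i _ =>
      continuous_finsetSum _ fun j _ => ?_)
    simp only [Matrix.sub_apply, answerMatrix, Matrix.of_apply]
    split_ifs <;> fun_prop
  have h0 := hc.tendsto ans₀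
  have hz : √(frobSq (answerMatrix M ans₀ - answerMatrix M ans₀)) = 0 := by simp [frobSq]
  rw [hz] at h0
  exact squeeze_zero (fun _ => dist_nonneg) (fun ans => abs_signedTerm_sub_le _ _ _) h0

theorem answerMatrix_vmvAnswer {d M : ℕ} {A : Matrix (Fin d) (Fin d) ℝ} (hA : Aᵀ = A)
    (x : Fin M → Fin d → ℝ) :
    (answerMatrix M fun j => vmvAnswer A (x (finProdFinEquiv.symm j).1)
      (x (finProdFinEquiv.symm j).2)) = offDiagSketch A x := by
  ext a b
  have hsym : x b ⬝ᵥ A *ᵥ x a = x a ⬝ᵥ A *ᵥ x b := by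
    rw [dotProduct_comm, Matrix.dotProduct_mulVec, ← Matrix.mulVec_transpose, hA]
  simp only [answerMatrix, offDiagSketch, Matrix.of_apply, vmvAnswer, Equiv.symm_apply_apply, hsym]
  split_ifs
  · rfl
  · rw [← two_mul, mul_div_mul_left _ _ two_ne_zero]

theorem frobSq_eq_frobNorm_sq {d : ℕ} (A : Matrix (Fin d) (Fin d) ℝ) :
    frobSq A = frobNorm A ^ 2 := by
  have h : frobNorm A = (∑ i, ∑ j, ‖A i j‖ ^ (2 : ℝ)) ^ (1 / 2 : ℝ) :=
    Matrix.frobenius_norm_def A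
  have h2 : frobNorm A = √(frobSq A) := by
    rw [h, Real.sqrt_eq_rpow]
    simp [frobSq]
  rw [h2, Real.sq_sqrt (frobSq_nonneg A)]

/-- The algorithm that queries all pairs from `M` independent uniform sign vectors. -/
noncomputable def signVectorAlgorithm {d k : ℕ} (M N : ℕ) (sel : (Fin N ⊕ Fin N → ℝ) → Fin k → ℝ)
    (hsel : Measurable sel) : NonadaptiveVMV d k (M * M) where
  Seed := Fin M → Fin d → Bool
  law := ProbabilityTheory.uniformOn Set.univ
  instIsProbabilityMeasure :=
    ProbabilityTheory.isProbabilityMeasure_uniformOn Set.finite_univ Set.univ_nonempty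
  left s j := signVector (s (finProdFinEquiv.symm j).1)
  right s j := signVector (s (finProdFinEquiv.symm j).2)
  output p := sel (sketchSpectrum M N p.2)
  measurable_left := measurable_of_finite _
  measurable_right := measurable_of_finite _
  measurable_output :=
    hsel.comp ((continuous_sketchSpectrum M N).measurable.comp measurable_snd)

theorem exists_nonadaptive {d k M : ℕ} [NeZero M] (hk : 1 ≤ k) (hkd : k ≤ d) {ε : ℝ} (hε : 0 < ε)
    (hM : 233280 / ε ^ 4 ≤ M) :
    ∃ alg : NonadaptiveVMV d k (M * M), alg.ApproximatesTopEigenvalues hk hkd ε := by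
  obtain ⟨sel, hsel, hsel'⟩ := exists_measurable_selection (X := Fin d ⊕ Fin d) (k := k) (by
    simp only [Fintype.card_sum, Fintype.card_fin]
    omega)
  refine ⟨signVectorAlgorithm M d sel hsel, fun A hA lam hlam => ?_⟩
  have hAT : Aᵀ = A := by rw [← Matrix.conjTranspose_eq_transpose_of_trivial, hA.eq]
  have hM0 : (0 : ℝ) < M := Nat.cast_pos.2 (NeZero.pos M)
  set F := frobNorm A with hF
  have hF2 : frobSq A = F ^ 2 := frobSq_eq_frobNorm_sq A
  have hF0 : 0 ≤ F := @norm_nonneg _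
    Matrix.frobeniusNormedAddCommGroup.toSeminormedAddCommGroup.toSeminormedAddGroup A
  -- The spectra will differ by at most η = 2δ, and the selection argument needs 3η ≤ εF.
  set δ := ε * F / 6 with hδ
  have hδ0 : 0 ≤ δ := by positivity
  -- Here 233280 = 18 · 10 · 6⁴, from the mean error, the failure probability and the choice of δ.
  have hexp : 𝔼 s : Fin M → Fin d → Bool, sketchError A (fun c => signVector (s c)) ≤
      1 / 10 * δ ^ 4 := by
    refine ((isotropicFamily_signVector d).expect_sketchError_le hAT).trans ?_
    rw [div_le_iff₀ (by positivity)] at hM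
    rw [hF2, div_le_iff₀ hM0, hδ]
    have := mul_le_mul_of_nonneg_right hM (by positivity : 0 ≤ F ^ 4)
    nlinarith
  have hmarkov := le_uniformOn_real_of_expect_le
    (fun s => add_nonneg (add_nonneg (frobSq_nonneg _) (frobSq_nonneg _)) (frobSq_nonneg _))
    (by positivity : 0 ≤ δ ^ 4) (by norm_num : (0 : ℝ) ≤ 1 / 10) hexp
  refine (by norm_num : (9 / 10 : ℝ) ≤ 1 - 1 / 10).trans (hmarkov.trans ?_)
  refine measureReal_mono (μ := ProbabilityTheory.uniformOn Set.univ) fun s hs => ?_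
  have hs' : sketchError A (fun c => signVector (s c)) ≤ δ ^ 4 := hs
  rw [sketchError] at hs'
  set x := fun c => signVector (s c) with hx
  have n1 := frobSq_nonneg ((rowSketch A x)ᵀ * rowSketch A x - A * A)
  have n2 := frobSq_nonneg (offDiagSketch A x * rowSketch A x - rowSketch A x * A)
  have n3 := frobSq_nonneg
    (rowSketch A x * (rowSketch A x)ᵀ - offDiagSketch A x * offDiagSketch A x)
  set ans : Fin (M * M) → ℝ := fun j =>
    vmvAnswer A (x (finProdFinEquiv.symm j).1) (x (finProdFinEquiv.symm j).2) with hans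
  have hmat : answerMatrix M ans = offDiagSketch A x := answerMatrix_vmvAnswer hAT x
  obtain ⟨e, he, hse⟩ := hsel' (sketchSpectrum M d ans)
  have hrun : (signVectorAlgorithm M d sel hsel).run A s = sketchSpectrum M d ans ∘ e := hse
  change AccurateTopEigenvalues hk hkd ε F lam ((signVectorAlgorithm M d sel hsel).run A s)
  rw [hrun]
  obtain ⟨⟨p, hp⟩, hanti⟩ := hlam
  obtain ⟨f, hf, hf0⟩ := exists_embedding_signedTerm (N := d) (Fintype.card_fin d).le hA.eigenvalues₀
    (p.trans (Fintype.equivOfCardEq (Fintype.card_fin _)).symm)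
  refine accurateTopEigenvalues_of_abs_sub_le hk hkd (η := 2 * δ) hanti f
    (c := fun x => signedTerm hA.eigenvalues₀ (Sum.map Fin.val Fin.val x)) (fun i => ?_) hf0
    (fun y => ?_) (by rw [hδ]; linarith) (fun h i => ?_) he
  · rw [hf, hp]
    rfl
  · refine abs_signedTerm_sub_le_of_frobSq_le hA (answerMatrix_isHermitian M ans) (rowSketch A x)
      hδ0 ?_ ?_ ?_ _
    · linarith
    · rw [hmat]
      linarith
    · rw [hmat]
      linarith
  · have hFz : F = 0 := (mul_eq_zero.1 h).resolve_left hε.ne'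
    have hAz : A = 0 :=
      (@norm_eq_zero _ Matrix.frobeniusNormedAddCommGroup.toNormedAddGroup A).1 hFz
    rw [hp, Function.comp_apply, hA.eigenvalues_eq_zero_iff.2 hAz]
    rfl

/-- A non-adaptive algorithm, viewed as a two-round algorithm without a second round. -/
noncomputable def NonadaptiveVMV.toTwoRound {d k q : ℕ} (alg : NonadaptiveVMV d k q) :
    TwoRoundVMV d k q 0 :=
  letI := alg.instMeasurableSpace
  { Seed := alg.Seed
    instMeasurableSpace := alg.instMeasurableSpace
    law := alg.law
    instIsProbabilityMeasure := alg.instIsProbabilityMeasure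
    left₁ := alg.left
    right₁ := alg.right
    left₂ := fun _ j => j.elim0
    right₂ := fun _ j => j.elim0
    output := fun p => alg.output (p.1, p.2.1)
    measurable_left₁ := alg.measurable_left
    measurable_right₁ := alg.measurable_right
    measurable_left₂ := measurable_pi_lambda _ fun j => j.elim0
    measurable_right₂ := measurable_pi_lambda _ fun j => j.elim0
    measurable_output := alg.measurable_output.comp
      (measurable_fst.prodMk (measurable_fst.comp measurable_snd)) }

theorem NonadaptiveVMV.ApproximatesTopEigenvalues.toTwoRound {d k q : ℕ}
    {alg : NonadaptiveVMV d k q} {hk : 1 ≤ k} {hkd : k ≤ d} {ε : ℝ}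
    (h : alg.ApproximatesTopEigenvalues hk hkd ε) :
    alg.toTwoRound.ApproximatesTopEigenvalues hk hkd ε :=
  h

end Algorithm

/-- Since M² = O(ε⁻⁸) is free of k and ε < 1, the same algorithm serves both clauses, with no
second-round queries. -/
theorem mainTheorem11 :
    ∃ C : ℝ, 0 < C ∧
      ∀ (d k : ℕ) (hk : 1 ≤ k) (hkd : k ≤ d) (ε : ℝ), 0 < ε → ε < 1 →
        (∃ (q : ℕ) (alg : NonadaptiveVMV d k q),
          (q : ℝ) ≤ C * ((k : ℝ) ^ 2 / ε ^ 12 * Real.log ((k : ℝ) + 1)) ∧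
            alg.ApproximatesTopEigenvalues hk hkd ε) ∧
        (∃ (q₁ q₂ : ℕ) (alg : TwoRoundVMV d k q₁ q₂),
          (q₁ : ℝ) + (q₂ : ℝ) ≤ C * ((k : ℝ) ^ 2 / ε ^ 8 * Real.log ((k : ℝ) + 1)) ∧
            alg.ApproximatesTopEigenvalues hk hkd ε) := by
  -- Rounding M up costs at most 1 ≤ 1/ε⁴, and the factor 2 pays for log(k + 1) ≥ log 2 > 1/2.
  refine ⟨2 * 233281 ^ 2, by norm_num, fun d k hk hkd ε hε hε1 => ?_⟩
  have hpos : 0 < 233280 / ε ^ 4 := by positivity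
  set M := ⌈233280 / ε ^ 4⌉₊ with hMdef
  have : NeZero M := ⟨(Nat.ceil_pos.2 hpos).ne'⟩
  obtain ⟨alg, halg⟩ := exists_nonadaptive (M := M) hk hkd hε (Nat.le_ceil _)
  have hone : 1 ≤ 1 / ε ^ 4 := one_le_one_div (by positivity) (pow_le_one₀ hε.le hε1.le)
  have hM : (M : ℝ) ≤ 233281 * (1 / ε ^ 4) := by
    have := Nat.ceil_lt_add_one hpos.le
    rw [← hMdef] at this
    have h : 233280 / ε ^ 4 = 233280 * (1 / ε ^ 4) := by ring
    linarith
  have hk1 : (1 : ℝ) ≤ k := by exact_mod_cast hk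
  have hlog : 1 / 2 ≤ Real.log ((k : ℝ) + 1) := by
    have h1 := Real.log_two_gt_d9
    have h2 : Real.log 2 ≤ Real.log ((k : ℝ) + 1) := Real.log_le_log two_pos (by linarith)
    linarith
  have hbound : ((M * M : ℕ) : ℝ) ≤
      2 * 233281 ^ 2 * ((k : ℝ) ^ 2 / ε ^ 8 * Real.log ((k : ℝ) + 1)) := by
    have hk2 : 1 / ε ^ 8 ≤ (k : ℝ) ^ 2 / ε ^ 8 :=
      div_le_div_of_nonneg_right (one_le_pow₀ hk1) (by positivity)
    calc ((M * M : ℕ) : ℝ) = (M : ℝ) * M := by push_cast; ring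
      _ ≤ (233281 * (1 / ε ^ 4)) * (233281 * (1 / ε ^ 4)) :=
        mul_le_mul hM hM (Nat.cast_nonneg _) (by positivity)
      _ = 2 * 233281 ^ 2 * (1 / ε ^ 8 * (1 / 2)) := by field_simp
      _ ≤ _ := by gcongr
  refine ⟨⟨M * M, alg, hbound.trans ?_, halg⟩, M * M, 0, alg.toTwoRound, ?_, halg.toTwoRound⟩
  · have h12 : ε ^ 12 ≤ ε ^ 8 := pow_le_pow_of_le_one hε.le hε1.le (by norm_num)
    gcongr
  · rw [Nat.cast_zero, add_zero]
    exact hbound
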